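/- **Theorem (Confidence optimality under the excessive bias restriction).** Let $\mathbb N=\{1,2,\dots\}$, $p\ge 0$, $\varepsilon>0$, $\sigma_i^2=\varepsilon^2 i^{2p}$, and let $X=(X_i)_{i\in\mathbb N}\sim \mathrm P_\theta=\bigotimes_i N(\theta_i,\sigma_i^2)$ with unknown $\theta\in\ell_2$. Fix $K\ge 1.87$ and $\alpha>0$ with $\alpha<a(K)=\frac14-\frac12\log\frac{K+1}{2}$, and put $\lambda_I=(e^\alpha-1)e^{-\alpha I}$, $X_i(I)=X_i 1\{i\le I\}$, $\tau_i^2(I)=K\sigma_i^2 1\{i\le I\}$. Write $\varphi(x,\mu,v)$ for the $N(\mu,v)$-density at $x$ and $N(\mu,0)$ for the Dirac measure at $\mu$. Consider the empirical-Bayes mixture $$\mathrm P(\cdot|X)=\sum_{I\in\mathbb N}\mathrm P(\mathcal I=I|X)\,\mathrm P_I(\cdot|X),\qquad \mathrm P_I(\cdot|X)=\bigotimes_i N\big(X_i(I),\tfrac{K}{K+1}\sigma_i^2 1\{i\le I\}\big),$$ where $\mathrm P(\mathcal I=I|X)$ is the almost sure limit, as $n\to\infty$, of $$\frac{\lambda_I\prod_{i\le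 n}\varphi(X_i,X_i(I),\tau_i^2(I)+\sigma_i^2)}{\sum_J\lambda_J\prod_{i\le n}\varphi(X_i,X_i(J),\tau_i^2(J)+\sigma_i^2)}.$$ Fix $q\in(\frac12,1)$ and $\varsigma>0$ (for instance $q=\frac23$, $\varsigma=\frac12$) and $\kappa\in(0,1)$. Let $\hat r^*=\inf\{r:\mathrm P(\|\theta-\theta'\|\le r\,|X)\ge q\text{ for some }\theta'\in\ell_2\}$. A default center is a measurable function $\check\theta=\check\theta(X)\in\ell_2$ of the data with $\mathrm P(\|\theta-\check\theta\|\le(1+\varsigma)\hat r^*\,|X)\ge q$ almost surely under every $\mathrm P_{\theta_0}$, $\theta_0\in\ell_2$. Let $\hat r_\kappa=\inf\{r:\mathrm P(\|\theta-\check\theta\|\le r\,|X)\ge1-\kappa\}$ and let $B(\check\theta,C\hat r_\kappa)=\{\theta\in\ell_2:\|\theta-\check\theta\|\le C\hat r_\kappa\}$ be the default credible ball. Let $r(\theta)\ge0$ be the oracle rate, $r^2(\theta)=\min_{I\in\mathbb N}\big\{\sum_{i\le I}\sigma_i^2+\sum_{i>I}\theta_i^2\big\}$. For $\tau>0$ let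 $\Theta_{eb}(\tau)=\Theta_{eb}(\tau,\varepsilon)$ be the set of $\theta\in\ell_2$ with $\sum_{i>\bar I_o}\theta_i^2\le\tau\sum_{i\le\bar I_o}\sigma_i^2$ for some minimizer $\bar I_o=\bar I_o(\theta)$ over $I\in\mathbb N$ of $I\varepsilon^2+\sum_{i>I}\theta_i^2 i^{-2p}$. Then for all $\tau>0$ and $\alpha_1,\alpha_2\in(0,1)$ there exist constants $C_0>0$, depending on $\alpha_1,\tau$ only, and $c_0>0$, depending on $\alpha_2$ only (besides the fixed $p,K,\alpha,\kappa,q,\varsigma$; in particular not on $\varepsilon$ or on the choice of $\check\theta$), such that for every $\varepsilon>0$, every default center $\check\theta$, all $C\ge C_0$ and all $c\ge c_0$, $$\sup_{\theta_0\in\Theta_{eb}(\tau)}\mathrm P_{\theta_0}\big(\theta_0\notin B(\check\theta,C\hat r_\kappa)\big)\le\alpha_1,\qquad \sup_{\theta_0\in\ell_2}\mathrm P_{\theta_0}\big(\hat r_\kappa\ge c\,r(\theta_0)\big)\le\alpha_2 .$$ -/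

import Mathlib

open MeasureTheory ProbabilityTheory Filter
open scoped ENNReal NNReal

noncomputable section

namespace SeqModel

/-- The parameter space `ℓ₂` of square-summable real sequences indexed by `{1, 2, 3, …}`,
with its Hilbert norm. -/
abbrev Ell2 : Type := lp (fun _ : ℕ+ => ℝ) 2

/-- The noise variances `σ_i² = ε² i^{2p}`. -/
def noiseVar (p ε : ℝ) (i : ℕ+) : ℝ := ε ^ 2 * ((i : ℕ) : ℝ) ^ (2 * p)

/-- The law `P_θ = ⨂_i N(θ_i, σ_i²)` of the observation `X = (X_i)_i`. -/
def obsLaw (p ε : ℝ) (θ : Ell2) : Measure (ℕ+ → ℝ) :=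
  Measure.infinitePi fun i => gaussianReal (θ i) (noiseVar p ε i).toNNReal

/-! ### The data-dependent measure -/

/-- The truncated data `X_i(I) = X_i 1{i ≤ I}`. -/
def truncData (X : ℕ+ → ℝ) (I i : ℕ+) : ℝ := if i ≤ I then X i else 0

/-- The variances `τ_i²(I) = K σ_i² 1{i ≤ I}`. -/
def priorVar (p ε K : ℝ) (I i : ℕ+) : ℝ := if i ≤ I then K * noiseVar p ε i else 0

/-- The weights `λ_I = (e^α - 1) e^{-α I}`. -/
def priorWeight (α : ℝ) (I : ℕ+) : ℝ :=
  (Real.exp α - 1) * Real.exp (-α * ((I : ℕ) : ℝ))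

/-- `λ_I ∏_{i ≤ n} φ(X_i, X_i(I), τ_i²(I) + σ_i²)`, where `φ(·, μ, v)` is the `N(μ, v)` density. -/
def marginal (p ε K α : ℝ) (X : ℕ+ → ℝ) (n I : ℕ+) : ℝ :=
  priorWeight α I * ∏ i ∈ Finset.Icc 1 n,
    gaussianPDFReal (truncData X I i) (priorVar p ε K I i + noiseVar p ε i).toNNReal (X i)

/-- `P_n(𝓘 = I | X)`, computed from the first `n` coordinates. -/
def indexProbTrunc (p ε K α : ℝ) (X : ℕ+ → ℝ) (n I : ℕ+) : ℝ :=
  marginal p ε K α X n I / ∑' J : ℕ+, marginal p ε K α X n J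

/-- `P(𝓘 = I | X)`, the almost sure limit of `P_n(𝓘 = I | X)` as `n → ∞`. -/
def indexProb (p ε K α : ℝ) (X : ℕ+ → ℝ) (I : ℕ+) : ℝ :=
  limUnder atTop fun n : ℕ+ => indexProbTrunc p ε K α X n I

/-- `P_I(· | X) = ⨂_i N(X_i(I), L σ_i² 1{i ≤ I})` with `L = K / (K + 1)`
(variance `0` gives a Dirac mass). -/
def componentDDM (p ε K : ℝ) (X : ℕ+ → ℝ) (I : ℕ+) : Measure (ℕ+ → ℝ) :=
  Measure.infinitePi fun i =>
    gaussianReal (truncData X I i)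
      (if i ≤ I then K / (K + 1) * noiseVar p ε i else 0).toNNReal

/-- The mixture `P(· | X) = ∑_I P_I(· | X) P(𝓘 = I | X)`. It charges only
finitely supported sequences, hence only `ℓ₂`. -/
def ddm (p ε K α : ℝ) (X : ℕ+ → ℝ) : Measure (ℕ+ → ℝ) :=
  Measure.sum fun I : ℕ+ => ENNReal.ofReal (indexProb p ε K α X I) • componentDDM p ε K X I

/-- `P(‖θ - c‖ ≤ r | X)`: the mass of the closed `ℓ₂`-ball of center `c` and radius `r`. -/
def ballMass (p ε K α : ℝ) (X : ℕ+ → ℝ) (c : Ell2) (r : ℝ) : ℝ≥0∞ :=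
  ddm p ε K α X ((fun θ : Ell2 => (θ : ℕ+ → ℝ)) '' Metric.closedBall c r)

/-! ### The default credible ball -/

/-- `r̂_κ = inf {r : P(‖θ - c‖ ≤ r | X) ≥ 1 - κ}` for the center `c`. -/
def credRadius (p ε K α κ : ℝ) (X : ℕ+ → ℝ) (c : Ell2) : ℝ :=
  sInf {r : ℝ | ENNReal.ofReal (1 - κ) ≤ ballMass p ε K α X c r}

/-- `r̂* = inf {r : P(‖θ - θ'‖ ≤ r | X) ≥ q for some θ' ∈ ℓ₂}`. -/
def minRadius (p ε K α q : ℝ) (X : ℕ+ → ℝ) : ℝ :=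
  sInf {r : ℝ | ∃ θ' : Ell2, ENNReal.ofReal q ≤ ballMass p ε K α X θ' r}

/-- `c` is a default DD-center with parameters `q` and `ς`: a measurable function of the data
with values in `ℓ₂` such that `P(‖θ - c(X)‖ ≤ (1 + ς) r̂* | X) ≥ q` almost surely under every `P_θ`.
As `ℓ₂` is separable, Borel measurability is measurability of all coordinates. -/
structure IsDefaultCenter (p ε K α q ς : ℝ) (c : (ℕ+ → ℝ) → Ell2) : Prop where
  measurable_coord : ∀ i : ℕ+, Measurable fun X => c X i
  mass_ge : ∀ θ : Ell2, ∀ᵐ X ∂(obsLaw p ε θ),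
    ENNReal.ofReal q ≤ ballMass p ε K α X (c X) ((1 + ς) * minRadius p ε K α q X)

/-! ### Oracle rate and excessive bias restriction -/

/-- `r²(I, θ) = ∑_{i ≤ I} σ_i² + ∑_{i > I} θ_i²`. -/
def localRateSq (p ε : ℝ) (θ : Ell2) (I : ℕ+) : ℝ :=
  ∑ i ∈ Finset.Icc 1 I, noiseVar p ε i + ∑' i : ℕ+, if I < i then θ i ^ 2 else 0

/-- The oracle rate `r(θ) = min_I r(I, θ)`. -/
def oracleRate (p ε : ℝ) (θ : Ell2) : ℝ := Real.sqrt (⨅ I : ℕ+, localRateSq p ε θ I)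

/-- `R²(I, θ) = I ε² + ∑_{i > I} θ_i² / κ_i²` with `κ_i² = i^{2p}`. -/
def surrogateRateSq (p ε : ℝ) (θ : Ell2) (I : ℕ+) : ℝ :=
  ((I : ℕ) : ℝ) * ε ^ 2 +
    ∑' i : ℕ+, if I < i then θ i ^ 2 / ((i : ℕ) : ℝ) ^ (2 * p) else 0

/-- `I` is a surrogate oracle, i.e. a minimizer of `R²(·, θ)`. -/
def IsSurrogateOracle (p ε : ℝ) (θ : Ell2) (I : ℕ+) : Prop :=
  ∀ J : ℕ+, surrogateRateSq p ε θ I ≤ surrogateRateSq p ε θ J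

/-- The excessive bias class `Θ_eb(τ)`: the bias at the surrogate oracle is at most `τ` times
the variance. If `R²(·, θ)` has several minimizers, it is enough that one of them qualifies, so the
class contains the one obtained from any rule for breaking ties. -/
def excessiveBiasClass (p ε τ : ℝ) : Set Ell2 :=
  {θ | ∃ I : ℕ+, IsSurrogateOracle p ε θ I ∧
    (∑' i : ℕ+, if I < i then θ i ^ 2 else 0) ≤ τ * ∑ i ∈ Finset.Icc 1 I, noiseVar p ε i}

end SeqModel

end

open SeqModel

open SeqModel

/-! The limiting index probabilities are proportional to `exp (score I)`, where `score` is a random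
walk with steps `X_i²/(2σ_i²) - coordPenalty`. The ratio to any reference index `J` therefore bounds
them by `exp (t (score I - score J))`, `0 ≤ t ≤ 1`, whose expectation is an explicit product of
Gaussian integrals (`indexProb_le`, `lintegral_weights_of_lt_le`, `lintegral_weights_of_gt_le`).

Two facts follow. Concentration around the truth (`exists_concentration`): with `R = r²(J, θ)`,
indices far above the level where the variance is of order `R`, and indices below it whose bias far
exceeds `R`, carry little expected weight; every other component has mean squared distance `O(R)`
from `θ`, and Markov's inequality concludes. No small balls (`exists_small_ball`): at a surrogate
oracle `J`, minimality makes the signal-to-noise sum over `(I, J]` at least `J - I`, so for `α <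
a(K)` indices well below `J` carry little weight. The remaining components have total variance
comparable to that at `J`, hence to `R` under the excessive bias restriction, and such a Gaussian
gives small mass to every ball of radius `δ√R`, uniformly in the center.

A ball around `θ` of mass near one must meet the ball of mass `q > 1/2` around the default center
(`dist_center_le_and_mass_ge`). This puts the center within `O(√R)` of `θ` and bounds the credible
radius above; the absence of small balls bounds the radius below, which gives coverage. -/

/-! ### Gaussian exponential-quadratic and second moments -/

theorem gaussianPDFReal_mul_exp_sq {m c v s x : ℝ} (hv : 0 < v) (hs : s < 1) :
    gaussianPDFReal m v.toNNReal x * Real.exp (s * (x - c) ^ 2 / (2 * v)) =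
      Real.exp (-(Real.log (1 - s) / 2) + s * (m - c) ^ 2 / (2 * v * (1 - s))) *
        gaussianPDFReal ((m - s * c) / (1 - s)) (v / (1 - s)).toNNReal x := by
  have h1 : 0 < 1 - s := by linarith
  have hlog : Real.exp (-(Real.log (1 - s) / 2)) = (√(1 - s))⁻¹ := by
    rw [Real.exp_neg, Real.sqrt_eq_rpow, Real.rpow_def_of_pos h1]; ring_nf
  rw [gaussianPDFReal, gaussianPDFReal, Real.coe_toNNReal _ hv.le,
    Real.coe_toNNReal _ (div_pos hv h1).le, Real.exp_add, hlog]
  have e1 : √(2 * Real.pi * (v / (1 - s))) = √(2 * Real.pi * v) / √(1 - s) := by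
    rw [← Real.sqrt_div (by positivity)]; congr 1; ring
  have h2 : √(1 - s) ≠ 0 := (Real.sqrt_pos.2 h1).ne'
  have e2 : -(x - m) ^ 2 / (2 * v) + s * (x - c) ^ 2 / (2 * v) =
      s * (m - c) ^ 2 / (2 * v * (1 - s)) +
        -(x - (m - s * c) / (1 - s)) ^ 2 / (2 * (v / (1 - s))) := by
    field_simp; ring
  rw [mul_assoc, ← Real.exp_add, e2, Real.exp_add, e1]
  field_simp

/-- Completing the square turns the tilted density into a constant times another Gaussian density.
Both signs of `s` matter: positive `s` controls indices that are too large, `s = -1` those that are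
too small, and negative `s` gives the Laplace transform behind the small-ball bound. -/
theorem lintegral_exp_sq_gaussianReal {m c v s : ℝ} (hv : 0 < v) (hs : s < 1) :
    ∫⁻ x, ENNReal.ofReal (Real.exp (s * (x - c) ^ 2 / (2 * v))) ∂(gaussianReal m v.toNNReal) =
      ENNReal.ofReal
        (Real.exp (-(Real.log (1 - s) / 2) + s * (m - c) ^ 2 / (2 * v * (1 - s)))) := by
  have h1 : 0 < 1 - s := by linarith
  have hv0 : v.toNNReal ≠ 0 := by simpa using hv
  have hv1 : (v / (1 - s)).toNNReal ≠ 0 := by simpa using div_pos hv h1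
  rw [gaussianReal_of_var_ne_zero _ hv0,
    lintegral_withDensity_eq_lintegral_mul _ (measurable_gaussianPDF _ _) (by fun_prop)]
  have : ∀ x, (gaussianPDF m v.toNNReal *
      fun x => ENNReal.ofReal (Real.exp (s * (x - c) ^ 2 / (2 * v)))) x =
      ENNReal.ofReal
        (Real.exp (-(Real.log (1 - s) / 2) + s * (m - c) ^ 2 / (2 * v * (1 - s)))) *
      gaussianPDF ((m - s * c) / (1 - s)) (v / (1 - s)).toNNReal x := by
    intro x
    rw [Pi.mul_apply, gaussianPDF, gaussianPDF, ← ENNReal.ofReal_mul (gaussianPDFReal_nonneg _ _ _),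
      ← ENNReal.ofReal_mul (Real.exp_pos _).le, gaussianPDFReal_mul_exp_sq hv hs]
  rw [lintegral_congr this, lintegral_const_mul _ (measurable_gaussianPDF _ _),
    lintegral_gaussianPDF_eq_one _ hv1, mul_one]

theorem lintegral_eval_infinitePi {ι : Type*} (P : ι → Measure ℝ) [∀ i, IsProbabilityMeasure (P i)]
    (i : ι) {f : ℝ → ℝ≥0∞} (hf : Measurable f) :
    ∫⁻ X, f (X i) ∂(Measure.infinitePi P) = ∫⁻ x, f x ∂(P i) := by
  rw [← Measure.infinitePi_map_eval P i, lintegral_map hf (measurable_pi_apply i)]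

theorem lintegral_exp_sum_sq {ι : Type*} (F : Finset ι) (m c s d : ι → ℝ) (v : ι → ℝ)
    (hv : ∀ i ∈ F, 0 < v i) (hs : ∀ i ∈ F, s i < 1) :
    ∫⁻ X, ENNReal.ofReal (Real.exp (∑ i ∈ F, (s i * (X i - c i) ^ 2 / (2 * v i) + d i)))
        ∂(Measure.infinitePi fun i => gaussianReal (m i) (v i).toNNReal) =
      ENNReal.ofReal (Real.exp (∑ i ∈ F, (-(Real.log (1 - s i) / 2) +
        s i * (m i - c i) ^ 2 / (2 * v i * (1 - s i)) + d i))) := by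
  have h1 : ∀ X : ι → ℝ, ENNReal.ofReal (Real.exp
      (∑ i ∈ F, (s i * (X i - c i) ^ 2 / (2 * v i) + d i))) =
      ∏ i ∈ F, ENNReal.ofReal (Real.exp (s i * (X i - c i) ^ 2 / (2 * v i) + d i)) := by
    intro X
    rw [Real.exp_sum, ENNReal.ofReal_prod_of_nonneg fun _ _ => (Real.exp_pos _).le]
  have hm : ∀ i, Measurable fun x : ℝ =>
      ENNReal.ofReal (Real.exp (s i * (x - c i) ^ 2 / (2 * v i) + d i)) := fun i => by fun_prop
  simp_rw [h1]
  rw [lintegral_prod_eq_prod_lintegral_of_indepFun F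
    (fun i (X : ι → ℝ) => ENNReal.ofReal (Real.exp (s i * (X i - c i) ^ 2 / (2 * v i) + d i)))
    (iIndepFun_infinitePi (X := fun i x =>
      ENNReal.ofReal (Real.exp (s i * (x - c i) ^ 2 / (2 * v i) + d i))) hm)
    (fun i => (hm i).comp (measurable_pi_apply i)), Real.exp_sum,
    ENNReal.ofReal_prod_of_nonneg fun _ _ => (Real.exp_pos _).le]
  refine Finset.prod_congr rfl fun i hi => ?_
  rw [lintegral_eval_infinitePi (fun i => gaussianReal (m i) (v i).toNNReal) i (hm i)]
  simp_rw [Real.exp_add _ (d i), ENNReal.ofReal_mul (Real.exp_pos _).le]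
  rw [lintegral_mul_const _ (by fun_prop), lintegral_exp_sq_gaussianReal (hv i hi) (hs i hi)]

theorem lintegral_sq_sub_gaussianReal (m a : ℝ) (v : ℝ≥0) :
    ∫⁻ x, ENNReal.ofReal ((x - a) ^ 2) ∂(gaussianReal m v) =
      ENNReal.ofReal (v + (m - a) ^ 2) := by
  have hL : MemLp (fun x : ℝ => x) 2 (gaussianReal m v) := memLp_id_gaussianReal' 2 (by simp)
  have hL' : MemLp (fun x : ℝ => x - a) 2 (gaussianReal m v) := hL.sub (memLp_const a)
  rw [← ofReal_integral_eq_lintegral_ofReal hL'.integrable_sq (ae_of_all _ fun x => sq_nonneg _)]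
  congr 1
  have h1 := variance_eq_sub hL'
  have h2 : Var[fun x => x - a; gaussianReal m v] = v := by
    rw [variance_sub_const hL.aestronglyMeasurable, variance_fun_id_gaussianReal]
  have h3 : ∫ x, (x - a) ∂(gaussianReal m v) = m - a := by
    rw [integral_sub (hL.integrable (by norm_num)) (integrable_const a), integral_id_gaussianReal]
    simp
  rw [h2, h3] at h1
  simp only [Pi.pow_apply] at h1
  linarith

/-! ### Index weights: closed form and limit -/

theorem noiseVar_pos {p ε : ℝ} (hε : 0 < ε) (i : ℕ+) : 0 < noiseVar p ε i := by
  have : (0 : ℝ) < ((i : ℕ) : ℝ) := by exact_mod_cast i.pos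
  unfold noiseVar; positivity

theorem PNat.sum_Icc_add_sum_Ioc {M : Type*} [AddCommMonoid M] (f : ℕ+ → M) {I J : ℕ+}
    (h : I ≤ J) :
    ∑ i ∈ Finset.Icc 1 I, f i + ∑ i ∈ Finset.Ioc I J, f i = ∑ i ∈ Finset.Icc 1 J, f i := by
  rw [← Finset.sum_union]
  · congr 1; ext i
    simp only [Finset.mem_union, Finset.mem_Icc, Finset.mem_Ioc, one_le, true_and]
    constructor
    · rintro (h1 | h1)
      · exact h1.trans h
      · exact h1.2
    · intro h1
      rcases le_or_gt i I with h2 | h2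
      · exact Or.inl h2
      · exact Or.inr ⟨h2, h1⟩
  · rw [Finset.disjoint_left]
    intro i h1 h2
    exact absurd (Finset.mem_Icc.1 h1).2 (not_le.2 (Finset.mem_Ioc.1 h2).1)

/-- The gain in log-weight that an additional coordinate has to make up for. -/
noncomputable def coordPenalty (K α : ℝ) : ℝ := Real.log (K + 1) / 2 + α

/-- The logarithm of the unnormalized weight of the index `I`. -/
noncomputable def score (p ε K α : ℝ) (X : ℕ+ → ℝ) (I : ℕ+) : ℝ :=
  ∑ i ∈ Finset.Icc 1 I, (X i ^ 2 / (2 * noiseVar p ε i) - coordPenalty K α)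

/-- The unnormalized index weights decay geometrically. -/
def ScoreDecay (p ε K α : ℝ) (X : ℕ+ → ℝ) : Prop :=
  ∃ C β : ℝ, 0 < β ∧ β ≤ α ∧ ∀ I : ℕ+,
    Real.exp (score p ε K α X I) ≤ C * Real.exp (-β * ((I : ℕ) : ℝ))

theorem score_sub {p ε K α : ℝ} {X : ℕ+ → ℝ} {I J : ℕ+} (h : I ≤ J) :
    score p ε K α X J - score p ε K α X I =
      ∑ i ∈ Finset.Ioc I J, (X i ^ 2 / (2 * noiseVar p ε i) - coordPenalty K α) := by
  rw [score, score, ← PNat.sum_Icc_add_sum_Ioc _ h, add_sub_cancel_left]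

/-- Centering at the observation itself leaves only the normalizing constant, so relative to the
`N(0, v)` density an included coordinate gains `x²/(2v)` and loses `log (K + 1) / 2`. -/
theorem gaussianPDFReal_inflate {K v x : ℝ} (hK : 0 < K + 1) (hv : 0 < v) :
    gaussianPDFReal x (K * v + v).toNNReal x =
      gaussianPDFReal 0 v.toNNReal x * Real.exp (x ^ 2 / (2 * v) - Real.log (K + 1) / 2) := by
  have hlog : Real.exp (Real.log (K + 1) / 2) = √(K + 1) := by
    rw [Real.sqrt_eq_rpow, Real.rpow_def_of_pos hK]; ring_nf
  have h1 : 0 < K * v + v := by nlinarith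
  have h2 : √(K + 1) ≠ 0 := (Real.sqrt_pos.2 hK).ne'
  have e1 : √(2 * Real.pi * (K * v + v)) = √(2 * Real.pi * v) * √(K + 1) := by
    rw [← Real.sqrt_mul (by positivity)]; congr 1; ring
  have e3 : -(x - 0) ^ 2 / (2 * v) = -(x ^ 2 / (2 * v)) := by ring
  rw [gaussianPDFReal, gaussianPDFReal, Real.coe_toNNReal _ hv.le, Real.coe_toNNReal _ h1.le,
    Real.exp_sub, hlog, e1, e3, Real.exp_neg]
  simp
  field_simp

/-- The prefactor does not depend on `I` and cancels on normalizing. An index beyond `n` sees only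
the first `n` observations, so it has the score of `n` and pays `α` for each further step. -/
theorem marginal_eq {p ε K α : ℝ} (hε : 0 < ε) (hK : 0 < K + 1) (X : ℕ+ → ℝ) (n I : ℕ+) :
    marginal p ε K α X n I =
      ((Real.exp α - 1) * ∏ i ∈ Finset.Icc 1 n, gaussianPDFReal 0 (noiseVar p ε i).toNNReal (X i)) *
        Real.exp (score p ε K α X (min I n) -
          α * (((I : ℕ) : ℝ) - (((min I n : ℕ+) : ℕ) : ℝ))) := by
  have h1 : ∀ i ∈ Finset.Icc 1 n,
      gaussianPDFReal (truncData X I i) (priorVar p ε K I i + noiseVar p ε i).toNNReal (X i) =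
      gaussianPDFReal 0 (noiseVar p ε i).toNNReal (X i) *
        (if i ≤ I then Real.exp (X i ^ 2 / (2 * noiseVar p ε i) - Real.log (K + 1) / 2) else 1) := by
    intro i _
    unfold truncData priorVar
    split_ifs with h
    · exact gaussianPDFReal_inflate hK (noiseVar_pos hε i)
    · simp
  have h2 : (Finset.Icc 1 n).filter (fun i => i ≤ I) = Finset.Icc 1 (min I n) := by
    ext i; simp [and_comm]
  rw [marginal, Finset.prod_congr rfl h1, Finset.prod_mul_distrib, ← Finset.prod_filter, h2,
    ← Real.exp_sum, priorWeight, score, Finset.sum_sub_distrib, Finset.sum_sub_distrib]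
  simp only [Finset.sum_const, PNat.card_Icc, nsmul_eq_mul, coordPenalty]
  have h3 : ∀ a b c d : ℝ, a * Real.exp b * (c * Real.exp d) = a * c * Real.exp (b + d) := by
    intro a b c d; rw [Real.exp_add]; ring
  rw [h3]
  congr 2
  have h4 : (((min I n : ℕ+) : ℕ) + 1 - ((1 : ℕ+) : ℕ)) = ((min I n : ℕ+) : ℕ) := by simp
  rw [h4]; ring

theorem summable_exp_neg_mul {β : ℝ} (hβ : 0 < β) :
    Summable fun I : ℕ+ => Real.exp (-β * ((I : ℕ) : ℝ)) := by
  have : Summable fun n : ℕ => Real.exp (-β * (n : ℝ)) := by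
    have := Real.summable_exp_nat_mul_iff.2 (neg_lt_zero.2 hβ)
    simpa [mul_comm] using this
  exact this.comp_injective PNat.coe_injective

namespace ScoreDecay

variable {p ε K α : ℝ} {X : ℕ+ → ℝ}

theorem summable (h : ScoreDecay p ε K α X) :
    Summable fun I => Real.exp (score p ε K α X I) := by
  obtain ⟨C, β, hβ, -, hC⟩ := h
  exact Summable.of_nonneg_of_le (fun _ => (Real.exp_pos _).le) hC
    ((summable_exp_neg_mul hβ).mul_left C)

theorem tsum_pos (h : ScoreDecay p ε K α X) : 0 < ∑' I, Real.exp (score p ε K α X I) :=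
  h.summable.tsum_pos (fun _ => (Real.exp_pos _).le) 1 (Real.exp_pos _)

theorem indexProb_eq (h : ScoreDecay p ε K α X) (hε : 0 < ε) (hK : 0 < K + 1) (hα : 0 < α)
    (I : ℕ+) :
    indexProb p ε K α X I =
      Real.exp (score p ε K α X I) / ∑' J, Real.exp (score p ε K α X J) := by
  set u : ℕ+ → ℕ+ → ℝ := fun n I => Real.exp (score p ε K α X (min I n) -
          α * (((I : ℕ) : ℝ) - (((min I n : ℕ+) : ℕ) : ℝ))) with hu
  have hD : ∀ n, 0 < ((Real.exp α - 1) *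
      ∏ i ∈ Finset.Icc 1 n, gaussianPDFReal 0 (noiseVar p ε i).toNNReal (X i)) := by
    intro n
    refine mul_pos (by simpa using hα) (Finset.prod_pos fun i _ => gaussianPDFReal_pos _ _ _ ?_)
    simpa using noiseVar_pos hε i
  have htrunc : ∀ n I, indexProbTrunc p ε K α X n I = u n I / ∑' J, u n J := by
    intro n I
    rw [indexProbTrunc]
    simp_rw [marginal_eq hε hK]
    rw [tsum_mul_left, mul_div_mul_left _ _ (hD n).ne']
  have hlim : ∀ J, Tendsto (fun n => u n J) atTop (nhds (Real.exp (score p ε K α X J))) := by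
    intro J
    refine tendsto_const_nhds.congr' ?_
    filter_upwards [eventually_ge_atTop J] with n hn
    simp [hu, min_eq_left hn]
  obtain ⟨C, β, hβ, hβα, hC⟩ := id h
  -- A dominating sequence uniform in `n`: up to `n` the decay has rate `β`, beyond `n` it has rate
  -- `α`, and `β ≤ α` merges the two.
  have hbound : ∀ n J, ‖u n J‖ ≤ C * Real.exp (-β * ((J : ℕ) : ℝ)) := by
    intro n J
    rw [Real.norm_of_nonneg (Real.exp_pos _).le]
    have h1 : (((min J n : ℕ+) : ℕ) : ℝ) ≤ ((J : ℕ) : ℝ) := by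
      exact_mod_cast (min_le_left J n : min J n ≤ J)
    have hC0 : 0 ≤ C := by
      by_contra hneg
      have := hC 1
      nlinarith [Real.exp_pos (score p ε K α X 1), Real.exp_pos (-β * (((1 : ℕ+) : ℕ) : ℝ))]
    simp only [sub_eq_add_neg (score p ε K α X (min J n)), Real.exp_add]
    calc _ ≤ C * Real.exp (-β * (((min J n : ℕ+) : ℕ) : ℝ)) *
          Real.exp (-(β * (((J : ℕ) : ℝ) - (((min J n : ℕ+) : ℕ) : ℝ)))) := by
          gcongr
          · exact hC _
      _ = _ := by rw [mul_assoc, ← Real.exp_add]; ring_nf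
  have hsum := tendsto_tsum_of_dominated_convergence ((summable_exp_neg_mul hβ).mul_left C) hlim
    (Eventually.of_forall hbound)
  rw [indexProb]
  simp_rw [htrunc]
  exact ((hlim I).div hsum h.tsum_pos.ne').limUnder_eq

/-- The probability is at most one and at most the ratio of the two weights; a power `t ≤ 1` of the
ratio dominates the minimum of these. Powers below one are needed for `I > J`, since `exp
(X_i²/(2σ_i²))` has infinite mean. -/
theorem indexProb_le (h : ScoreDecay p ε K α X) (hε : 0 < ε) (hK : 0 < K + 1) (hα : 0 < α)
    (I J : ℕ+) {t : ℝ} (ht0 : 0 ≤ t) (ht1 : t ≤ 1) :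
    indexProb p ε K α X I ≤ Real.exp (t * (score p ε K α X I - score p ε K α X J)) := by
  rw [h.indexProb_eq hε hK hα]
  have hle : ∀ J, Real.exp (score p ε K α X J) ≤ ∑' I, Real.exp (score p ε K α X I) :=
    fun J => h.summable.le_tsum J fun _ _ => (Real.exp_pos _).le
  rcases le_or_gt 0 (score p ε K α X I - score p ε K α X J) with h1 | h1
  · calc _ ≤ 1 := (div_le_one h.tsum_pos).2 (hle I)
      _ ≤ _ := Real.one_le_exp (mul_nonneg ht0 h1)
  · calc _ ≤ Real.exp (score p ε K α X I) / Real.exp (score p ε K α X J) := by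
          gcongr; exact hle J
      _ = Real.exp (score p ε K α X I - score p ε K α X J) := (Real.exp_sub _ _).symm
      _ ≤ _ := by
          apply Real.exp_le_exp.2
          nlinarith

theorem tsum_indexProb (h : ScoreDecay p ε K α X) (hε : 0 < ε) (hK : 0 < K + 1) (hα : 0 < α) :
    ∑' I, ENNReal.ofReal (indexProb p ε K α X I) = 1 := by
  simp_rw [h.indexProb_eq hε hK hα]
  rw [← ENNReal.ofReal_tsum_of_nonneg (fun I => div_nonneg (Real.exp_pos _).le h.tsum_pos.le)
    (h.summable.div_const _), tsum_div_const, div_self h.tsum_pos.ne', ENNReal.ofReal_one]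

end ScoreDecay

/-! ### Moments of the weights and almost sure decay -/

instance (p ε : ℝ) (θ : Ell2) : IsProbabilityMeasure (obsLaw p ε θ) := by
  unfold obsLaw; infer_instance

instance (p ε K : ℝ) (X : ℕ+ → ℝ) (I : ℕ+) : IsProbabilityMeasure (componentDDM p ε K X I) := by
  unfold componentDDM; infer_instance

theorem measurable_score (p ε K α : ℝ) (I : ℕ+) :
    Measurable fun X : ℕ+ → ℝ => score p ε K α X I := by
  unfold score
  exact Finset.measurable_fun_sum _ fun i _ =>
    (((measurable_pi_apply i).pow_const 2).div_const _).sub_const _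

theorem Ell2.summable_sq (θ : Ell2) : Summable fun i => θ i ^ 2 := by
  have h := (memℓp_gen_iff (p := 2) (by norm_num)).1 (lp.memℓp θ)
  simpa using h

theorem sq_le_noiseVar {p ε : ℝ} (hp : 0 ≤ p) (i : ℕ+) : ε ^ 2 ≤ noiseVar p ε i := by
  have h1 : (1 : ℝ) ≤ ((i : ℕ) : ℝ) ^ (2 * p) :=
    Real.one_le_rpow (by exact_mod_cast i.pos) (by linarith)
  unfold noiseVar
  nlinarith [sq_nonneg ε]

/-- Here the full power is integrable, because the squared observations enter with a negative sign:
each coordinate contributes `E exp (-X_i²/(2σ_i²)) = 2^{-1/2} exp (-θ_i²/(4σ_i²))`. -/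
theorem lintegral_exp_score_sub_of_le {p ε K α : ℝ} (hε : 0 < ε) (θ : Ell2) {I J : ℕ+}
    (h : I ≤ J) :
    ∫⁻ X, ENNReal.ofReal (Real.exp (score p ε K α X I - score p ε K α X J)) ∂(obsLaw p ε θ) =
      ENNReal.ofReal (Real.exp (∑ i ∈ Finset.Ioc I J,
        (coordPenalty K α - Real.log 2 / 2 - θ i ^ 2 / noiseVar p ε i / 4))) := by
  have h1 := lintegral_exp_sum_sq (Finset.Ioc I J) (fun i => θ i) (fun _ => 0) (fun _ => -1)
    (fun _ => coordPenalty K α) (noiseVar p ε) (fun i _ => noiseVar_pos hε i)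
    (fun _ _ => by norm_num)
  have h2 : ∀ X, score p ε K α X I - score p ε K α X J = ∑ i ∈ Finset.Ioc I J,
      (-1 * (X i - 0) ^ 2 / (2 * noiseVar p ε i) + coordPenalty K α) := by
    intro X
    rw [← neg_sub, score_sub h, ← Finset.sum_neg_distrib]
    exact Finset.sum_congr rfl fun i _ => by ring
  simp_rw [h2, obsLaw]
  rw [h1]
  congr 2
  refine Finset.sum_congr rfl fun i _ => ?_
  have := (noiseVar_pos (p := p) hε i).ne'
  have h3 : (1 : ℝ) - -1 = 2 := by norm_num
  rw [h3]; field_simp; ring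

/-- The exponential decay rate of the `t`-th moment of the weights. -/
noncomputable def momentRate (K α t : ℝ) : ℝ := t * coordPenalty K α + Real.log (1 - t) / 2

theorem lintegral_exp_mul_sum {p ε K α t : ℝ} (hε : 0 < ε) (ht : t < 1) (θ : Ell2)
    (F : Finset ℕ+) :
    ∫⁻ X, ENNReal.ofReal (Real.exp (t * ∑ i ∈ F,
        (X i ^ 2 / (2 * noiseVar p ε i) - coordPenalty K α))) ∂(obsLaw p ε θ) =
      ENNReal.ofReal (Real.exp (∑ i ∈ F,
        (t / (2 * (1 - t)) * (θ i ^ 2 / noiseVar p ε i) - momentRate K α t))) := by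
  have h1 := lintegral_exp_sum_sq F (fun i => θ i) (fun _ => 0) (fun _ => t)
    (fun _ => -(t * coordPenalty K α)) (noiseVar p ε) (fun i _ => noiseVar_pos hε i)
    (fun _ _ => ht)
  have h2 : ∀ X : ℕ+ → ℝ, t * ∑ i ∈ F, (X i ^ 2 / (2 * noiseVar p ε i) - coordPenalty K α) =
      ∑ i ∈ F, (t * (X i - 0) ^ 2 / (2 * noiseVar p ε i) + -(t * coordPenalty K α)) := by
    intro X
    rw [Finset.mul_sum]
    exact Finset.sum_congr rfl fun i _ => by ring
  simp_rw [h2, obsLaw]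
  rw [h1]
  congr 2
  refine Finset.sum_congr rfl fun i _ => ?_
  have := (noiseVar_pos (p := p) hε i).ne'
  have h3 : 1 - t ≠ 0 := by linarith
  unfold momentRate
  field_simp; ring

theorem half_lt_coordPenalty {K α : ℝ} (hK : 1.87 ≤ K) (hα : 0 < α) :
    1 / 2 < coordPenalty K α := by
  have h1 : 1 ≤ Real.log (K + 1) := by
    rw [Real.le_log_iff_exp_le (by linarith)]
    have := Real.exp_one_lt_d9
    norm_num at this hK ⊢
    linarith
  unfold coordPenalty; linarith

/-- `momentRate` vanishes at `t = 0` with slope `coordPenalty - 1/2`, which is positive because `K +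
1 ≥ e`. -/
theorem exists_momentRate_pos {K α : ℝ} (hK : 1.87 ≤ K) (hα : 0 < α) :
    ∃ t : ℝ, 0 < t ∧ t < 1 ∧ 0 < momentRate K α t := by
  have hl := half_lt_coordPenalty hK hα
  set l := coordPenalty K α with hl_def
  -- Since `log (1 - t) ≥ -t/(1 - t)`, any `t` in `(0, 1 - 1/(2l))` works; the midpoint is taken.
  refine ⟨(1 - 1 / (2 * l)) / 2, ?_, ?_, ?_⟩
  · have : 1 / (2 * l) < 1 := by rw [div_lt_one (by linarith)]; linarith
    linarith
  · have : 0 < 1 / (2 * l) := by apply div_pos <;> linarith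
    linarith
  · set t := (1 - 1 / (2 * l)) / 2 with ht
    have h0 : 1 / (2 * l) < 1 := by rw [div_lt_one (by linarith)]; linarith
    have h0' : 0 < 1 / (2 * l) := by apply div_pos <;> linarith
    have h1 : 0 < 1 - t := by rw [ht]; linarith
    have htpos : 0 < t := by rw [ht]; linarith
    have h2 := Real.one_sub_inv_le_log_of_pos h1
    have h3 : 1 - (1 - t)⁻¹ = - (t / (1 - t)) := by field_simp; ring
    have h4 : 1 / (2 * l) < 1 - t := by rw [ht]; linarith
    have h5 : 1 < 2 * l * (1 - t) := by
      rw [div_lt_iff₀ (by linarith)] at h4; linarith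
    have h6 : t / (1 - t) < t * (2 * l) := by
      rw [div_lt_iff₀ h1]; nlinarith
    unfold momentRate
    rw [← hl_def]; linarith

/-- The `t`-th moments of the weights decay geometrically, as the total signal-to-noise ratio is at
most `‖θ‖²/ε²`. Hence a geometrically weighted sum of `t`-th powers has finite mean, is almost
surely finite, and bounds each of its terms. -/
theorem ae_scoreDecay {p ε K α : ℝ} (hp : 0 ≤ p) (hε : 0 < ε) (hK : 1.87 ≤ K) (hα : 0 < α)
    (θ : Ell2) : ∀ᵐ X ∂(obsLaw p ε θ), ScoreDecay p ε K α X := by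
  obtain ⟨t, ht0, ht1, hb⟩ := exists_momentRate_pos hK hα
  set b := momentRate K α t
  set A := t / (2 * (1 - t)) with hA
  have hA0 : 0 ≤ A := div_nonneg ht0.le (by linarith)
  -- The bound `tβ ≤ b/2` spends half of the decay rate `b` and leaves `b/2` for summability.
  set β := min α (b / (2 * t)) with hβ
  have hβ0 : 0 < β := lt_min hα (by positivity)
  have hβb : t * β ≤ b / 2 := by
    have : β ≤ b / (2 * t) := min_le_right _ _
    rw [le_div_iff₀ (by positivity)] at this; linarith
  set S := ∑' i, θ i ^ 2
  have hbound : ∀ I : ℕ+,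
      ∫⁻ X, ENNReal.ofReal (Real.exp (t * score p ε K α X I + t * β * ((I : ℕ) : ℝ)))
        ∂(obsLaw p ε θ) ≤
      ENNReal.ofReal (Real.exp (A * (S / ε ^ 2)) * Real.exp (-(b / 2) * ((I : ℕ) : ℝ))) := by
    intro I
    simp_rw [Real.exp_add, ENNReal.ofReal_mul (Real.exp_pos _).le]
    rw [lintegral_mul_const _ (by
      have := measurable_score p ε K α I
      fun_prop)]
    unfold score
    rw [lintegral_exp_mul_sum hε ht1, ← ENNReal.ofReal_mul (Real.exp_pos _).le,
      ← ENNReal.ofReal_mul (Real.exp_pos _).le, ← Real.exp_add, ← Real.exp_add]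
    apply ENNReal.ofReal_le_ofReal
    apply Real.exp_le_exp.2
    rw [Finset.sum_sub_distrib, ← Finset.mul_sum]
    have h1 : ∑ i ∈ Finset.Icc 1 I, θ i ^ 2 / noiseVar p ε i ≤ S / ε ^ 2 := by
      calc _ ≤ ∑ i ∈ Finset.Icc 1 I, θ i ^ 2 / ε ^ 2 := by
            gcongr; exact sq_le_noiseVar hp _
        _ = (∑ i ∈ Finset.Icc 1 I, θ i ^ 2) / ε ^ 2 := by rw [Finset.sum_div]
        _ ≤ _ := by
            gcongr; exact (Ell2.summable_sq θ).sum_le_tsum _ fun _ _ => sq_nonneg _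
    simp only [Finset.sum_const, PNat.card_Icc, nsmul_eq_mul, PNat.val_ofNat,
      Nat.add_sub_cancel]
    have hI : (0 : ℝ) ≤ ((I : ℕ) : ℝ) := by positivity
    have := mul_le_mul_of_nonneg_left h1 hA0
    have := mul_le_mul_of_nonneg_right hβb hI
    change _ - _ * b + _ ≤ _
    linarith
  have hfin : ∫⁻ X, ∑' I : ℕ+,
      ENNReal.ofReal (Real.exp (t * score p ε K α X I + t * β * ((I : ℕ) : ℝ)))
        ∂(obsLaw p ε θ) ≠ ∞ := by
    have hm : ∀ I : ℕ+, Measurable fun X =>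
        ENNReal.ofReal (Real.exp (t * score p ε K α X I + t * β * ((I : ℕ) : ℝ))) := by
      intro I
      have := measurable_score p ε K α I
      fun_prop
    rw [lintegral_tsum fun I => (hm I).aemeasurable]
    refine ne_top_of_le_ne_top ?_ (ENNReal.tsum_le_tsum hbound)
    rw [← ENNReal.ofReal_tsum_of_nonneg (fun I => by positivity)
      ((summable_exp_neg_mul (half_pos hb)).mul_left _)]
    exact ENNReal.ofReal_ne_top
  have hmeas : Measurable fun X : ℕ+ → ℝ => ∑' I : ℕ+,
      ENNReal.ofReal (Real.exp (t * score p ε K α X I + t * β * ((I : ℕ) : ℝ))) := by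
    refine Measurable.tsum fun I => ?_
    have := measurable_score p ε K α I
    fun_prop
  filter_upwards [ae_lt_top hmeas hfin] with X hX
  set T := ∑' I : ℕ+, ENNReal.ofReal (Real.exp (t * score p ε K α X I + t * β * ((I : ℕ) : ℝ)))
  refine ⟨Real.exp (Real.log T.toReal / t), β, hβ0, min_le_left _ _, fun I => ?_⟩
  have h1 : Real.exp (t * score p ε K α X I + t * β * ((I : ℕ) : ℝ)) ≤ T.toReal := by
    rw [← ENNReal.ofReal_le_iff_le_toReal hX.ne]
    exact ENNReal.le_tsum I
  have h2 := (Real.le_log_iff_exp_le ((Real.exp_pos _).trans_le h1)).2 h1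
  rw [← Real.exp_add]
  apply Real.exp_le_exp.2
  have h3 : score p ε K α X I + β * ((I : ℕ) : ℝ) ≤ Real.log T.toReal / t := by
    rw [le_div_iff₀ ht0]; linarith
  linarith

/-! ### Balls, and their mass under a single component -/

/-- The closed `ℓ₂`-ball as a set of sequences. -/
def seqBall (c : Ell2) (r : ℝ) : Set (ℕ+ → ℝ) :=
  (fun θ : Ell2 => (θ : ℕ+ → ℝ)) '' Metric.closedBall c r

/-- The extended-valued sum makes the ball a sublevel set of a measurable function; finiteness of
the sum already forces membership in `ℓ₂`. -/
theorem mem_seqBall_iff {c : Ell2} {r : ℝ} (hr : 0 ≤ r) {x : ℕ+ → ℝ} :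
    x ∈ seqBall c r ↔ ∑' i, ENNReal.ofReal ((x i - c i) ^ 2) ≤ ENNReal.ofReal (r ^ 2) := by
  have h2 : (0 : ℝ) < (2 : ℝ≥0∞).toReal := by norm_num
  have key : ∀ θ : Ell2, ∑' i, ENNReal.ofReal ((θ i - c i) ^ 2) = ENNReal.ofReal (‖θ - c‖ ^ 2) := by
    intro θ
    have h := lp.norm_rpow_eq_tsum h2 (θ - c)
    simp at h
    rw [h, ENNReal.ofReal_tsum_of_nonneg (fun _ => sq_nonneg _)]
    simpa using Ell2.summable_sq (θ - c)
  constructor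
  · rintro ⟨θ, hθ, rfl⟩
    rw [key]
    rw [Metric.mem_closedBall, dist_eq_norm] at hθ
    exact ENNReal.ofReal_le_ofReal (by gcongr)
  · intro h
    have hs : Summable fun i => (x i - c i) ^ 2 := by
      have h1 : Summable fun i => ((x i - c i) ^ 2).toNNReal :=
        ENNReal.tsum_coe_ne_top_iff_summable.1 (ne_top_of_le_ne_top ENNReal.ofReal_ne_top h)
      have h3 := NNReal.summable_coe.2 h1
      simpa [Real.coe_toNNReal _ (sq_nonneg _)] using h3
    have hm : Memℓp (fun i => x i - c i) 2 := memℓp_gen (by simpa using hs)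
    let d : Ell2 := ⟨fun i => x i - c i, hm⟩
    have hx : ((d + c : Ell2) : ℕ+ → ℝ) = x := by
      ext i
      exact sub_add_cancel (x i) (c i)
    refine ⟨d + c, ?_, hx⟩
    have h4 := key (d + c)
    rw [hx] at h4
    rw [h4, ENNReal.ofReal_le_ofReal_iff (sq_nonneg _)] at h
    rw [Metric.mem_closedBall, dist_eq_norm]
    exact (sq_le_sq₀ (norm_nonneg _) hr).1 h

theorem seqBall_eq_empty {c : Ell2} {r : ℝ} (hr : r < 0) : seqBall c r = ∅ := by
  rw [seqBall, Metric.closedBall_eq_empty.2 hr, Set.image_empty]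

theorem measurable_tsum_sq_sub (c : ℕ+ → ℝ) :
    Measurable fun x : ℕ+ → ℝ => ∑' i, ENNReal.ofReal ((x i - c i) ^ 2) :=
  Measurable.tsum fun i =>
    (((measurable_pi_apply i).sub_const _).pow_const 2).ennreal_ofReal

theorem measurableSet_seqBall (c : Ell2) (r : ℝ) : MeasurableSet (seqBall c r) := by
  rcases lt_or_ge r 0 with hr | hr
  · rw [seqBall_eq_empty hr]; exact MeasurableSet.empty
  · have : seqBall c r =
        {x | ∑' i, ENNReal.ofReal ((x i - c i) ^ 2) ≤ ENNReal.ofReal (r ^ 2)} := by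
      ext x; exact mem_seqBall_iff hr
    rw [this]
    exact measurableSet_le (measurable_tsum_sq_sub _) measurable_const

theorem ballMass_eq (p ε K α : ℝ) (X : ℕ+ → ℝ) (c : Ell2) (r : ℝ) :
    ballMass p ε K α X c r = ddm p ε K α X (seqBall c r) := rfl

theorem ddm_apply (p ε K α : ℝ) (X : ℕ+ → ℝ) (s : Set (ℕ+ → ℝ)) :
    ddm p ε K α X s =
      ∑' I, ENNReal.ofReal (indexProb p ε K α X I) * componentDDM p ε K X I s := by
  rw [ddm, Measure.sum_apply_of_countable]; rfl

theorem ScoreDecay.isProbabilityMeasure {p ε K α : ℝ} {X : ℕ+ → ℝ} (h : ScoreDecay p ε K α X)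
    (hε : 0 < ε) (hK : 0 < K + 1) (hα : 0 < α) : IsProbabilityMeasure (ddm p ε K α X) := by
  constructor
  rw [ddm_apply]
  simp [h.tsum_indexProb hε hK hα]

theorem summable_ite_lt {f : ℕ+ → ℝ} (hf : Summable f) (I : ℕ+) :
    Summable fun i : ℕ+ => if I < i then f i else 0 := by
  have h : (fun i : ℕ+ => if I < i then f i else 0) = (Set.Ioi I).indicator f := by
    ext i
    simp [Set.indicator]
  rw [h]
  exact hf.indicator _

theorem tsum_ite_lt_eq_sum_add {f : ℕ+ → ℝ} (hf : Summable f) {I J : ℕ+} (h : I ≤ J) :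
    (∑' i, if I < i then f i else 0) =
      ∑ i ∈ Finset.Ioc I J, f i + ∑' i, if J < i then f i else 0 := by
  have h1 : ∀ i : ℕ+, (if I < i then f i else 0) =
      (if i ∈ Finset.Ioc I J then f i else 0) + (if J < i then f i else 0) := by
    intro i
    simp only [Finset.mem_Ioc]
    rcases lt_or_ge I i with h2 | h2 <;> rcases lt_or_ge J i with h3 | h3
    · simp [h2, h3]
    · simp [h2, not_lt.2 h3, h3]
    · exact absurd (h.trans_lt h3) (not_lt.2 h2)
    · simp [not_lt.2 h2, not_lt.2 h3]
  have h2 : Summable fun i : ℕ+ => if i ∈ Finset.Ioc I J then f i else 0 :=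
    summable_of_ne_finset_zero (s := Finset.Ioc I J) fun i hi => by simp [hi]
  rw [tsum_congr h1, h2.tsum_add (summable_ite_lt hf J),
    tsum_eq_sum (s := Finset.Ioc I J) fun i hi => by simp [hi]]
  congr 1
  exact Finset.sum_congr rfl fun i hi => by simp [hi]

/-- The squared bias `∑_{i > I} θ_i²`. -/
noncomputable def biasSq (θ : Ell2) (I : ℕ+) : ℝ := ∑' i : ℕ+, if I < i then θ i ^ 2 else 0

theorem biasSq_nonneg (θ : Ell2) (I : ℕ+) : 0 ≤ biasSq θ I :=
  tsum_nonneg fun i => by split_ifs <;> positivity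

theorem biasSq_eq_sum_add (θ : Ell2) {I J : ℕ+} (h : I ≤ J) :
    biasSq θ I = ∑ i ∈ Finset.Ioc I J, θ i ^ 2 + biasSq θ J :=
  tsum_ite_lt_eq_sum_add (Ell2.summable_sq θ) h

theorem biasSq_anti (θ : Ell2) {I J : ℕ+} (h : I ≤ J) : biasSq θ J ≤ biasSq θ I := by
  rw [biasSq_eq_sum_add θ h]
  have : 0 ≤ ∑ i ∈ Finset.Ioc I J, θ i ^ 2 := Finset.sum_nonneg fun _ _ => sq_nonneg _
  linarith

theorem componentDDM_compl_seqBall_le {p ε K r : ℝ} (hε : 0 < ε) (hK : 0 < K) (hr : 0 < r)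
    (X : ℕ+ → ℝ) (θ : Ell2) (I : ℕ+) :
    componentDDM p ε K X I (seqBall θ r)ᶜ ≤
      (∑ i ∈ Finset.Icc 1 I, ENNReal.ofReal (noiseVar p ε i + (X i - θ i) ^ 2) +
        ENNReal.ofReal (biasSq θ I)) / ENNReal.ofReal (r ^ 2) := by
  have hsub : (seqBall θ r)ᶜ ⊆
      {x | ENNReal.ofReal (r ^ 2) ≤ ∑' i, ENNReal.ofReal ((x i - θ i) ^ 2)} := by
    intro x hx
    rw [Set.mem_compl_iff, mem_seqBall_iff hr.le, not_le] at hx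
    exact hx.le
  refine (measure_mono hsub).trans ((meas_ge_le_lintegral_div
    (measurable_tsum_sq_sub _).aemeasurable (by simpa using hr.ne') ENNReal.ofReal_ne_top).trans ?_)
  gcongr
  rw [lintegral_tsum fun i =>
    (((measurable_pi_apply i).sub_const _).pow_const 2).ennreal_ofReal.aemeasurable]
  have hL : K / (K + 1) ≤ 1 := by rw [div_le_one (by linarith)]; linarith
  have h1 : ∀ i, ∫⁻ x, ENNReal.ofReal ((x i - θ i) ^ 2) ∂(componentDDM p ε K X I) ≤
      (if i ∈ Finset.Icc 1 I then ENNReal.ofReal (noiseVar p ε i + (X i - θ i) ^ 2) else 0) +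
        ENNReal.ofReal (if I < i then θ i ^ 2 else 0) := by
    intro i
    rw [componentDDM, lintegral_eval_infinitePi _ i
      (f := fun y => ENNReal.ofReal ((y - θ i) ^ 2)) (by fun_prop), lintegral_sq_sub_gaussianReal]
    have hσ := noiseVar_pos (p := p) hε i
    rcases le_or_gt i I with h | h
    · have h0 : 0 ≤ K / (K + 1) * noiseVar p ε i := by positivity
      simp only [truncData, h, if_true, Finset.mem_Icc, one_le, true_and, not_lt.2 h, if_false,
        ENNReal.ofReal_zero, add_zero, Real.coe_toNNReal _ h0]
      apply ENNReal.ofReal_le_ofReal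
      nlinarith
    · simp [truncData, not_le.2 h, h]
  refine (ENNReal.tsum_le_tsum h1).trans ?_
  rw [ENNReal.tsum_add, tsum_eq_sum (s := Finset.Icc 1 I) (fun i hi => by simp [hi]),
    ← ENNReal.ofReal_tsum_of_nonneg (fun i => by split_ifs <;> positivity)
      (summable_ite_lt (Ell2.summable_sq θ) I)]
  refine le_of_eq ?_
  rw [← biasSq]
  congr 1
  exact Finset.sum_congr rfl fun i hi => by simp [hi]

/-- Chernoff's bound with `exp (-t ‖x - c‖²)`. The bound is free of `c` and `X`, so it applies to
data-dependent centers. -/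
theorem componentDDM_seqBall_le {p ε K r t : ℝ} (hε : 0 < ε) (hK : 0 < K) (hr : 0 ≤ r)
    (ht : 0 ≤ t) (X : ℕ+ → ℝ) (c : Ell2) (I : ℕ+) :
    componentDDM p ε K X I (seqBall c r) ≤ ENNReal.ofReal (Real.exp (t * r ^ 2 -
      ∑ i ∈ Finset.Icc 1 I, Real.log (1 + 2 * t * (K / (K + 1) * noiseVar p ε i)) / 2)) := by
  set v : ℕ+ → ℝ := fun i => if i ≤ I then K / (K + 1) * noiseVar p ε i else 0 with hv
  have hvI : ∀ i ∈ Finset.Icc 1 I, v i = K / (K + 1) * noiseVar p ε i := fun i hi => by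
    simp [hv, (Finset.mem_Icc.1 hi).2]
  have hvpos : ∀ i ∈ Finset.Icc 1 I, 0 < v i := fun i hi => by
    rw [hvI i hi]; have := noiseVar_pos (p := p) hε i; positivity
  have hs : ∀ i ∈ Finset.Icc 1 I, -(2 * t * v i) < 1 := fun i hi => by
    have := mul_nonneg ht (hvpos i hi).le; linarith
  set f : (ℕ+ → ℝ) → ℝ≥0∞ := fun x => ENNReal.ofReal (Real.exp (∑ i ∈ Finset.Icc 1 I,
    (-(2 * t * v i) * (x i - c i) ^ 2 / (2 * v i) + 0))) with hf
  have hmeas : Measurable f := by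
    have : Measurable fun x : ℕ+ → ℝ => ∑ i ∈ Finset.Icc 1 I,
      (-(2 * t * v i) * (x i - c i) ^ 2 / (2 * v i) + 0) :=
      Finset.measurable_fun_sum _ fun i _ =>
        ((((((measurable_pi_apply i).sub_const _).pow_const 2).const_mul _).div_const _).add_const _)
    fun_prop
  have hsub : seqBall c r ⊆ {x | ENNReal.ofReal (Real.exp (-(t * r ^ 2))) ≤ f x} := by
    intro x hx
    rw [mem_seqBall_iff hr] at hx
    apply ENNReal.ofReal_le_ofReal
    apply Real.exp_le_exp.2
    have h1 : ∑ i ∈ Finset.Icc 1 I, (x i - c i) ^ 2 ≤ r ^ 2 := by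
      rw [← ENNReal.ofReal_le_ofReal_iff (sq_nonneg _),
        ENNReal.ofReal_sum_of_nonneg fun _ _ => sq_nonneg _]
      exact (ENNReal.sum_le_tsum _).trans hx
    have h2 : ∑ i ∈ Finset.Icc 1 I, (-(2 * t * v i) * (x i - c i) ^ 2 / (2 * v i) + 0) =
        -(t * ∑ i ∈ Finset.Icc 1 I, (x i - c i) ^ 2) := by
      rw [Finset.mul_sum, ← Finset.sum_neg_distrib]
      refine Finset.sum_congr rfl fun i hi => ?_
      have := (hvpos i hi).ne'
      field_simp; ring
    rw [h2]
    have := mul_le_mul_of_nonneg_left h1 ht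
    linarith
  refine (measure_mono hsub).trans ((meas_ge_le_lintegral_div hmeas.aemeasurable
    (by simpa using Real.exp_pos _) ENNReal.ofReal_ne_top).trans ?_)
  rw [hf, componentDDM, lintegral_exp_sum_sq (Finset.Icc 1 I) _ _ (fun i => -(2 * t * v i)) _ v
    hvpos hs, ← ENNReal.ofReal_div_of_pos (Real.exp_pos _), ← Real.exp_sub]
  apply ENNReal.ofReal_le_ofReal
  apply Real.exp_le_exp.2
  have h3 : ∑ i ∈ Finset.Icc 1 I, (-(Real.log (1 - -(2 * t * v i)) / 2) +
      -(2 * t * v i) * (truncData X I i - c i) ^ 2 / (2 * v i * (1 - -(2 * t * v i))) + 0) ≤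
      ∑ i ∈ Finset.Icc 1 I, -(Real.log (1 + 2 * t * (K / (K + 1) * noiseVar p ε i)) / 2) := by
    refine Finset.sum_le_sum fun i hi => ?_
    have h4 := hvpos i hi
    have h5 : 0 ≤ 2 * t * v i := by positivity
    -- An offset between center and mean only lowers the Laplace transform.
    have h6 : -(2 * t * v i) * (truncData X I i - c i) ^ 2 / (2 * v i * (1 - -(2 * t * v i))) ≤ 0 := by
      apply div_nonpos_of_nonpos_of_nonneg
      · nlinarith [sq_nonneg (truncData X I i - c i)]
      · apply mul_nonneg <;> linarith
    rw [sub_neg_eq_add] at h6 ⊢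
    rw [← hvI i hi]
    linarith
  rw [Finset.sum_neg_distrib] at h3
  linarith

/-! ### Variance sums, tails and signal-to-noise comparisons -/

theorem half_mul_le_sum_Icc {f : ℕ+ → ℝ} {a : ℝ} (I : ℕ+) (hf : ∀ i, 0 ≤ f i) (ha : 0 ≤ a)
    (h : ∀ i : ℕ+, i ≤ I → (I : ℕ) ≤ 2 * (i : ℕ) → a ≤ f i) :
    ((I : ℕ) : ℝ) / 2 * a ≤ ∑ i ∈ Finset.Icc 1 I, f i := by
  have hI := I.pos
  -- The indices from `⌈I/2⌉` to `I` number at least `I/2`.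
  let m : ℕ+ := ⟨((I : ℕ) + 1) / 2, by omega⟩
  have hm : (m : ℕ) = ((I : ℕ) + 1) / 2 := rfl
  calc ((I : ℕ) : ℝ) / 2 * a ≤ (((Finset.Icc m I).card : ℕ) : ℝ) * a := by
        gcongr
        rw [PNat.card_Icc, div_le_iff₀ (by norm_num)]
        have : (I : ℕ) ≤ ((I : ℕ) + 1 - (m : ℕ)) * 2 := by omega
        exact_mod_cast this
    _ = ∑ i ∈ Finset.Icc m I, a := by simp
    _ ≤ ∑ i ∈ Finset.Icc m I, f i := by
        refine Finset.sum_le_sum fun i hi => ?_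
        rw [Finset.mem_Icc] at hi
        have h1 : (m : ℕ) ≤ (i : ℕ) := by exact_mod_cast hi.1
        exact h i hi.2 (by omega)
    _ ≤ _ := Finset.sum_le_sum_of_subset_of_nonneg
        (Finset.Icc_subset_Icc (one_le) le_rfl) fun i _ _ => hf i

theorem sum_noiseVar_le {p : ℝ} (hp : 0 ≤ p) (ε : ℝ) (I : ℕ+) :
    ∑ i ∈ Finset.Icc 1 I, noiseVar p ε i ≤ ε ^ 2 * ((I : ℕ) : ℝ) ^ (2 * p + 1) := by
  have hI : (0 : ℝ) < ((I : ℕ) : ℝ) := by exact_mod_cast I.pos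
  calc _ ≤ ∑ i ∈ Finset.Icc 1 I, ε ^ 2 * ((I : ℕ) : ℝ) ^ (2 * p) := by
        refine Finset.sum_le_sum fun i hi => ?_
        have : (i : ℕ) ≤ (I : ℕ) := by exact_mod_cast (Finset.mem_Icc.1 hi).2
        unfold noiseVar; gcongr
    _ = _ := by
        rw [Finset.sum_const, PNat.card_Icc, Real.rpow_add hI, Real.rpow_one]
        simp; ring

theorem le_sum_noiseVar {p : ℝ} (hp : 0 ≤ p) (ε : ℝ) (I : ℕ+) :
    ε ^ 2 * ((I : ℕ) : ℝ) ^ (2 * p + 1) ≤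
      (2 : ℝ) ^ (2 * p + 1) * ∑ i ∈ Finset.Icc 1 I, noiseVar p ε i := by
  have hI : (0 : ℝ) < ((I : ℕ) : ℝ) := by exact_mod_cast I.pos
  have h1 := half_mul_le_sum_Icc (f := noiseVar p ε) (a := ε ^ 2 * (((I : ℕ) : ℝ) / 2) ^ (2 * p)) I
    (fun i => by unfold noiseVar; positivity) (by positivity) (fun i _ h => by
      have : ((I : ℕ) : ℝ) ≤ 2 * ((i : ℕ) : ℝ) := by exact_mod_cast h
      unfold noiseVar
      gcongr
      linarith)
  have h2 : (0 : ℝ) < (2 : ℝ) ^ (2 * p + 1) := by positivity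
  calc _ = (2 : ℝ) ^ (2 * p + 1) * (((I : ℕ) : ℝ) / 2 * (ε ^ 2 * (((I : ℕ) : ℝ) / 2) ^ (2 * p))) := by
        rw [Real.div_rpow hI.le (by norm_num), Real.rpow_add hI, Real.rpow_one,
          Real.rpow_add (by norm_num : (0 : ℝ) < 2), Real.rpow_one]
        field_simp
    _ ≤ _ := by gcongr

theorem exists_tail_sum_le {A b δ : ℝ} (hb : 0 < b) (hδ : 0 < δ) :
    ∃ N : ℕ+, ∀ J : ℕ+, (∑' I : ℕ+, if N * J < I then
      ENNReal.ofReal (Real.exp (A * ((J : ℕ) : ℝ) - b * (((I : ℕ) : ℝ) - ((J : ℕ) : ℝ)))) else 0) ≤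
        ENNReal.ofReal δ := by
  set S := ∑' I : ℕ+, Real.exp (-(b / 4) * ((I : ℕ) : ℝ)) with hS
  have hsum : Summable fun I : ℕ+ => Real.exp (-(b / 4) * ((I : ℕ) : ℝ)) :=
    summable_exp_neg_mul (by linarith)
  have hSpos : 0 < S := hsum.tsum_pos (fun _ => (Real.exp_pos _).le) 1 (Real.exp_pos _)
  -- For `I > NJ` the first bound absorbs `(A + b) J` into `bI/2`. Of the remaining `bI/2`, one half
  -- gives the factor `δ/S` by the second bound, the other half sums to `S`.
  obtain ⟨n, hn⟩ := exists_nat_ge (max (2 * (A + b) / b) (4 / b * Real.log (S / δ)))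
  have hn1 : 2 * (A + b) / b ≤ n + 1 := by linarith [(le_max_left _ _).trans hn]
  have hn2 : 4 / b * Real.log (S / δ) ≤ n + 1 := by linarith [(le_max_right _ _).trans hn]
  refine ⟨n.succPNat, fun J => ?_⟩
  have hJ : (1 : ℝ) ≤ ((J : ℕ) : ℝ) := by exact_mod_cast J.pos
  have key : ∀ I : ℕ+, (if n.succPNat * J < I then
      ENNReal.ofReal (Real.exp (A * ((J : ℕ) : ℝ) - b * (((I : ℕ) : ℝ) - ((J : ℕ) : ℝ)))) else 0) ≤
      ENNReal.ofReal (δ / S * Real.exp (-(b / 4) * ((I : ℕ) : ℝ))) := by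
    intro I
    split_ifs with h
    · apply ENNReal.ofReal_le_ofReal
      have h1 : ((n : ℝ) + 1) * ((J : ℕ) : ℝ) ≤ ((I : ℕ) : ℝ) := by
        have : ((n + 1) * (J : ℕ) : ℕ) < (I : ℕ) := by exact_mod_cast h
        exact_mod_cast this.le
      have h2 : Real.exp (-(b / 4) * (n + 1)) ≤ δ / S := by
        rw [← Real.le_log_iff_exp_le (by positivity)]
        have h3 : Real.log (δ / S) = -Real.log (S / δ) := by
          rw [← Real.log_inv, inv_div]
        rw [h3]
        have h4 := mul_le_mul_of_nonneg_left hn2 (by positivity : 0 ≤ b / 4)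
        have h5 : b / 4 * (4 / b * Real.log (S / δ)) = Real.log (S / δ) := by field_simp
        linarith
      refine le_trans ?_ (mul_le_mul_of_nonneg_right h2 (Real.exp_pos _).le)
      rw [← Real.exp_add]
      apply Real.exp_le_exp.2
      rw [div_le_iff₀ hb] at hn1
      have h6 : (A + b) * ((J : ℕ) : ℝ) ≤ b / 2 * ((I : ℕ) : ℝ) := by
        calc _ ≤ (b / 2 * (n + 1)) * ((J : ℕ) : ℝ) := by gcongr; linarith
          _ = b / 2 * ((n + 1) * ((J : ℕ) : ℝ)) := by ring
          _ ≤ _ := by gcongr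
      have h7 : (n : ℝ) + 1 ≤ ((I : ℕ) : ℝ) := by
        have : (0 : ℝ) ≤ n := by positivity
        nlinarith
      have h8 := mul_le_mul_of_nonneg_left h7 (by positivity : 0 ≤ b / 4)
      linarith
    · exact zero_le
  refine (ENNReal.tsum_le_tsum key).trans ?_
  rw [← ENNReal.ofReal_tsum_of_nonneg (fun I => by positivity) (hsum.mul_left _), tsum_mul_left,
    ← hS, div_mul_cancel₀ _ hSpos.ne']

theorem tsum_ite_lt_const_le (J : ℕ+) (P : ℕ+ → Prop) [DecidablePred P] (hP : ∀ I, P I → I < J)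
    (a : ℝ) :
    (∑' I : ℕ+, if P I then ENNReal.ofReal a else 0) ≤ ENNReal.ofReal (((J : ℕ) : ℝ) * a) := by
  have h1 : ∀ I : ℕ+, (if P I then ENNReal.ofReal a else 0) ≤
      if I ∈ Finset.Icc 1 J then ENNReal.ofReal a else 0 := by
    intro I
    by_cases h : P I
    · simp [h, (hP I h).le]
    · simp [h]
  refine (ENNReal.tsum_le_tsum h1).trans (le_of_eq ?_)
  rw [tsum_eq_sum (s := Finset.Icc 1 J) fun i hi => by simp [hi],
    Finset.sum_congr rfl fun i hi => if_pos hi, Finset.sum_const, PNat.card_Icc,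
    ENNReal.ofReal_mul (by positivity)]
  simp

theorem mul_exp_neg_mul_le {m x : ℝ} (hm : 0 < m) : x * Real.exp (-(m * x)) ≤ 1 / m := by
  rw [Real.exp_neg, ← div_eq_mul_inv, div_le_div_iff₀ (Real.exp_pos _) hm]
  have := Real.add_one_le_exp (m * x)
  linarith

/-- Raises `J` to a level where the variance matches a prescribed size `y`. Rounding down `2
y^{1/s}`, `s = 2p + 1`, loses at most a factor two, because `n + 1 ≤ 2n`. -/
theorem exists_index_comparable {p y : ℝ} (hp : 0 ≤ p) {J : ℕ+}
    (hJ : ((J : ℕ) : ℝ) ^ (2 * p + 1) ≤ (2 : ℝ) ^ (2 * p + 1) * y) :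
    ∃ J' : ℕ+, J ≤ J' ∧ y ≤ ((J' : ℕ) : ℝ) ^ (2 * p + 1) ∧
      ((J' : ℕ) : ℝ) ^ (2 * p + 1) ≤ (2 : ℝ) ^ (2 * p + 1) * y := by
  set s := 2 * p + 1 with hs
  have hs0 : 0 < s := by linarith
  have hJ1 : (1 : ℝ) ≤ ((J : ℕ) : ℝ) := by exact_mod_cast J.pos
  set z := (2 : ℝ) ^ s * y with hz
  have hz0 : 0 < z := lt_of_lt_of_le (by positivity) hJ
  have hzr : (z ^ s⁻¹) ^ s = z := Real.rpow_inv_rpow hz0.le hs0.ne'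
  have hJz : ((J : ℕ) : ℝ) ≤ z ^ s⁻¹ := by
    rw [← Real.rpow_le_rpow_iff (by positivity) (by positivity) hs0, hzr]
    exact hJ
  set n := ⌊z ^ s⁻¹⌋₊ with hn
  have hJn : (J : ℕ) ≤ n := Nat.le_floor hJz
  have hn0 : 0 < n := J.pos.trans_le hJn
  refine ⟨⟨n, hn0⟩, hJn, ?_, ?_⟩
  · have h1 : z ^ s⁻¹ < n + 1 := Nat.lt_floor_add_one _
    have hn1 : (1 : ℝ) ≤ n := by exact_mod_cast hn0
    have h2 : z ≤ (2 * n : ℝ) ^ s := by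
      rw [← hzr]
      gcongr
      linarith
    rw [Real.mul_rpow (by norm_num) (by positivity), hz] at h2
    exact le_of_mul_le_mul_left h2 (by positivity)
  · have h1 : (n : ℝ) ≤ z ^ s⁻¹ := Nat.floor_le (by positivity)
    calc ((n : ℕ) : ℝ) ^ s ≤ (z ^ s⁻¹) ^ s := by gcongr
      _ = z := hzr

theorem sum_sq_div_noiseVar_le {p ε : ℝ} (hp : 0 ≤ p) (hε : 0 < ε) (θ : Ell2) {I J : ℕ+}
    (h : I ≤ J) :
    ∑ i ∈ Finset.Ioc I J, θ i ^ 2 / noiseVar p ε i ≤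
      (biasSq θ I) / (ε ^ 2 * ((I : ℕ) : ℝ) ^ (2 * p)) := by
  have hI : (0 : ℝ) < ((I : ℕ) : ℝ) := by exact_mod_cast I.pos
  have h0 : 0 < ε ^ 2 * ((I : ℕ) : ℝ) ^ (2 * p) := by positivity
  calc _ ≤ ∑ i ∈ Finset.Ioc I J, θ i ^ 2 / (ε ^ 2 * ((I : ℕ) : ℝ) ^ (2 * p)) := by
        refine Finset.sum_le_sum fun i hi => ?_
        have : (I : ℕ) ≤ (i : ℕ) := by exact_mod_cast (Finset.mem_Ioc.1 hi).1.le
        unfold noiseVar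
        gcongr
    _ = (∑ i ∈ Finset.Ioc I J, θ i ^ 2) / (ε ^ 2 * ((I : ℕ) : ℝ) ^ (2 * p)) := by
        rw [Finset.sum_div]
    _ ≤ _ := by
        gcongr
        rw [biasSq_eq_sum_add θ h]
        linarith [biasSq_nonneg θ J]

theorem le_sum_sq_div_noiseVar {p ε : ℝ} (hp : 0 ≤ p) (hε : 0 < ε) (θ : Ell2) {I J : ℕ+}
    (h : I ≤ J) :
    (biasSq θ I - biasSq θ J) / (ε ^ 2 * ((J : ℕ) : ℝ) ^ (2 * p)) ≤
      ∑ i ∈ Finset.Ioc I J, θ i ^ 2 / noiseVar p ε i := by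
  rw [biasSq_eq_sum_add θ h, add_sub_cancel_right, Finset.sum_div]
  refine Finset.sum_le_sum fun i hi => ?_
  have h0 := noiseVar_pos (p := p) hε i
  have : (i : ℕ) ≤ (J : ℕ) := by exact_mod_cast (Finset.mem_Ioc.1 hi).2
  unfold noiseVar at h0 ⊢
  gcongr

/-- Comparing `R²(J, θ)` with `R²(I, θ)`: the coordinates in `(I, J]` must pay for their `J - I`
units of noise. -/
theorem le_sum_sq_div_noiseVar_of_surrogate {p ε : ℝ} (hp : 0 ≤ p) (hε : 0 < ε) {θ : Ell2}
    {I J : ℕ+} (hJ : IsSurrogateOracle p ε θ J) (h : I ≤ J) :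
    ((J : ℕ) : ℝ) - ((I : ℕ) : ℝ) ≤ ∑ i ∈ Finset.Ioc I J, θ i ^ 2 / noiseVar p ε i := by
  have hs : Summable fun i : ℕ+ => θ i ^ 2 / ((i : ℕ) : ℝ) ^ (2 * p) := by
    refine Summable.of_nonneg_of_le (fun i => by positivity) (fun i => ?_) (Ell2.summable_sq θ)
    exact div_le_self (sq_nonneg _)
      (Real.one_le_rpow (by exact_mod_cast i.pos) (by linarith))
  have h1 := hJ I
  rw [surrogateRateSq, surrogateRateSq, tsum_ite_lt_eq_sum_add hs h] at h1
  have h2 : ∑ i ∈ Finset.Ioc I J, θ i ^ 2 / noiseVar p ε i =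
      (∑ i ∈ Finset.Ioc I J, θ i ^ 2 / ((i : ℕ) : ℝ) ^ (2 * p)) / ε ^ 2 := by
    rw [Finset.sum_div]
    refine Finset.sum_congr rfl fun i _ => ?_
    rw [noiseVar, div_div, mul_comm]
  rw [h2, le_div_iff₀ (by positivity)]
  linarith

theorem PNat.cast_card_Ioc {I J : ℕ+} (h : I ≤ J) :
    (((Finset.Ioc I J).card : ℕ) : ℝ) = ((J : ℕ) : ℝ) - ((I : ℕ) : ℝ) := by
  rw [PNat.card_Ioc, Nat.cast_sub (by exact_mod_cast h)]

/-- This is the condition `α < a(K)`: the cost per coordinate in `lintegral_exp_score_sub_of_le`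
stays below the `1/4` per coordinate that surrogate minimality supplies. -/
theorem coordPenalty_sub_lt {K α : ℝ} (hK : 1.87 ≤ K)
    (hαK : α < 1 / 4 - 1 / 2 * Real.log ((K + 1) / 2)) :
    coordPenalty K α - Real.log 2 / 2 < 1 / 4 := by
  rw [Real.log_div (by linarith) (by norm_num)] at hαK
  unfold coordPenalty; linarith

theorem coordPenalty_sub_nonneg {K α : ℝ} (hK : 1.87 ≤ K) (hα : 0 < α) :
    0 ≤ coordPenalty K α - Real.log 2 / 2 := by
  have : Real.log 2 ≤ Real.log (K + 1) := Real.log_le_log (by norm_num) (by linarith)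
  unfold coordPenalty; linarith

theorem exists_componentDDM_seqBall_le {p K η : ℝ} (hp : 0 ≤ p) (hK : 0 < K) (hη : 0 < η) :
    ∃ δ : ℝ, 0 < δ ∧ ∀ ε : ℝ, 0 < ε → ∀ (X : ℕ+ → ℝ) (c : Ell2) (I : ℕ+) (r : ℝ), 0 ≤ r →
      r ^ 2 ≤ δ * (ε ^ 2 * ((I : ℕ) : ℝ) ^ (2 * p + 1)) →
        componentDDM p ε K X I (seqBall c r) ≤ ENNReal.ofReal η := by
  set Λ := max 0 (-Real.log η) with hΛ
  have hΛ0 : 0 ≤ Λ := le_max_left _ _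
  have hΛη : Real.exp (-Λ) ≤ η := by
    rw [← Real.le_log_iff_exp_le hη]
    linarith [le_max_right 0 (-Real.log η)]
  set L := K / (K + 1) with hL
  have hL0 : 0 < L := by positivity
  set Q := Real.exp (4 * (1 + Λ)) with hQ
  have hQ0 : 0 < Q := Real.exp_pos _
  have h2p : (0 : ℝ) < (2 : ℝ) ^ (2 * p) := by positivity
  refine ⟨2 * L / (Q * 2 ^ (2 * p)), by positivity, fun ε hε X c I r hr hrI => ?_⟩
  set δ := 2 * L / (Q * 2 ^ (2 * p)) with hδ
  have hδ0 : 0 < δ := by positivity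
  have hI : (1 : ℝ) ≤ ((I : ℕ) : ℝ) := by exact_mod_cast I.pos
  have hI0 : (0 : ℝ) < ((I : ℕ) : ℝ) := by linarith
  -- Then `t r² ≤ I`, while each coordinate in the upper half contributes at least `2(1 + Λ)`, so
  -- the exponent is at most `-IΛ ≤ -Λ`.
  set t := 1 / (δ * (ε ^ 2 * ((I : ℕ) : ℝ) ^ (2 * p))) with ht
  have ht0 : 0 < t := by positivity
  refine (componentDDM_seqBall_le hε hK hr ht0.le X c I).trans
    (ENNReal.ofReal_le_ofReal (le_trans (Real.exp_le_exp.2 ?_) hΛη))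
  have h1 : t * r ^ 2 ≤ ((I : ℕ) : ℝ) := by
    calc _ ≤ t * (δ * (ε ^ 2 * ((I : ℕ) : ℝ) ^ (2 * p + 1))) := by gcongr
      _ = _ := by
        rw [ht, Real.rpow_add hI0, Real.rpow_one]; field_simp
  have h2 := half_mul_le_sum_Icc
    (f := fun i => Real.log (1 + 2 * t * (L * noiseVar p ε i)) / 2) (a := Real.log (1 + Q) / 2) I
    (fun i => by
      have := noiseVar_pos (p := p) hε i
      exact div_nonneg (Real.log_nonneg (by
        have : 0 ≤ 2 * t * (L * noiseVar p ε i) := by positivity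
        linarith)) (by norm_num))
    (div_nonneg (Real.log_nonneg (by linarith)) (by norm_num))
    (fun i _ h => by
      have hi : ((I : ℕ) : ℝ) / 2 ≤ ((i : ℕ) : ℝ) := by
        have : ((I : ℕ) : ℝ) ≤ 2 * ((i : ℕ) : ℝ) := by exact_mod_cast h
        linarith
      have h3 : Q ≤ 2 * t * (L * noiseVar p ε i) := by
        calc Q = 2 * t * (L * (ε ^ 2 * (((I : ℕ) : ℝ) / 2) ^ (2 * p))) := by
              rw [ht, hδ, Real.div_rpow hI0.le (by norm_num)]; field_simp
          _ ≤ _ := by unfold noiseVar; gcongr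
      gcongr)
  have h4 : 4 * (1 + Λ) ≤ Real.log (1 + Q) := by
    rw [Real.le_log_iff_exp_le (by positivity)]; linarith
  have h5 : ((I : ℕ) : ℝ) / 2 * ((4 * (1 + Λ)) / 2) ≤ ((I : ℕ) : ℝ) / 2 * (Real.log (1 + Q) / 2) := by
    gcongr
  have h6 : Λ ≤ ((I : ℕ) : ℝ) * Λ := le_mul_of_one_le_left hΛ0 hI
  linarith

theorem measurable_exp_mul_score_sub (p ε K α t : ℝ) (I J : ℕ+) :
    Measurable fun X : ℕ+ → ℝ =>
      ENNReal.ofReal (Real.exp (t * (score p ε K α X I - score p ε K α X J))) := by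
  have h1 := measurable_score p ε K α I
  have h2 := measurable_score p ε K α J
  fun_prop

theorem lintegral_tsum_ite {Ω ι : Type*} [MeasurableSpace Ω] [Countable ι] (μ : Measure Ω)
    (P : ι → Prop) [DecidablePred P] {f : ι → Ω → ℝ≥0∞} (hf : ∀ i, Measurable (f i)) :
    ∫⁻ x, (∑' i, if P i then f i x else 0) ∂μ = ∑' i, if P i then ∫⁻ x, f i x ∂μ else 0 := by
  rw [lintegral_tsum fun i => by
    by_cases h : P i
    · simpa [h] using (hf i).aemeasurable
    · simp [h]]
  refine tsum_congr fun i => ?_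
  by_cases h : P i <;> simp [h]

theorem measurable_tsum_ite {Ω ι : Type*} [MeasurableSpace Ω] [Countable ι]
    (P : ι → Prop) [DecidablePred P] {f : ι → Ω → ℝ≥0∞} (hf : ∀ i, Measurable (f i)) :
    Measurable fun x => ∑' i, if P i then f i x else 0 :=
  Measurable.tsum fun i => by
    by_cases h : P i
    · simpa [h] using hf i
    · simp [h]

theorem localRateSq_eq (p ε : ℝ) (θ : Ell2) (J : ℕ+) :
    localRateSq p ε θ J = ∑ i ∈ Finset.Icc 1 J, noiseVar p ε i + biasSq θ J := rfl

theorem sum_noiseVar_pos {p ε : ℝ} (hε : 0 < ε) (J : ℕ+) :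
    0 < ∑ i ∈ Finset.Icc 1 J, noiseVar p ε i :=
  Finset.sum_pos (fun i _ => noiseVar_pos hε i) ⟨1, by simp⟩

theorem localRateSq_pos {p ε : ℝ} (hε : 0 < ε) (θ : Ell2) (J : ℕ+) :
    0 < localRateSq p ε θ J := by
  rw [localRateSq_eq]
  linarith [sum_noiseVar_pos (p := p) hε J, biasSq_nonneg θ J]

theorem lintegral_weights_of_lt_le {p ε K α m : ℝ} (hε : 0 < ε) (θ : Ell2) {I J : ℕ+}
    (h : I ≤ J) (hm : m ≤ ∑ i ∈ Finset.Ioc I J, θ i ^ 2 / noiseVar p ε i) :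
    ∫⁻ X, ENNReal.ofReal (Real.exp (1 * (score p ε K α X I - score p ε K α X J)))
        ∂(obsLaw p ε θ) ≤
      ENNReal.ofReal (Real.exp ((((J : ℕ) : ℝ) - ((I : ℕ) : ℝ)) *
        (coordPenalty K α - Real.log 2 / 2) - m / 4)) := by
  simp_rw [one_mul]
  rw [lintegral_exp_score_sub_of_le hε θ h]
  apply ENNReal.ofReal_le_ofReal
  apply Real.exp_le_exp.2
  rw [Finset.sum_sub_distrib, Finset.sum_const, nsmul_eq_mul, PNat.cast_card_Ioc h,
    ← Finset.sum_div]
  linarith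

theorem lintegral_weights_of_gt_le {p ε K α t m : ℝ} (hε : 0 < ε) (ht0 : 0 ≤ t) (ht : t < 1)
    (θ : Ell2) {I J : ℕ+} (h : J ≤ I)
    (hm : ∑ i ∈ Finset.Ioc J I, θ i ^ 2 / noiseVar p ε i ≤ m) :
    ∫⁻ X, ENNReal.ofReal (Real.exp (t * (score p ε K α X I - score p ε K α X J)))
        ∂(obsLaw p ε θ) ≤
      ENNReal.ofReal (Real.exp (t / (2 * (1 - t)) * m -
        momentRate K α t * (((I : ℕ) : ℝ) - ((J : ℕ) : ℝ)))) := by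
  simp_rw [score_sub h]
  rw [lintegral_exp_mul_sum hε ht]
  apply ENNReal.ofReal_le_ofReal
  apply Real.exp_le_exp.2
  rw [Finset.sum_sub_distrib, Finset.sum_const, nsmul_eq_mul, PNat.cast_card_Ioc h,
    ← Finset.mul_sum]
  have h1 : 0 ≤ t / (2 * (1 - t)) := div_nonneg ht0 (by linarith)
  have := mul_le_mul_of_nonneg_left hm h1
  linarith

theorem lintegral_sum_noiseVar_add_sq {p ε : ℝ} (hε : 0 < ε) (θ : Ell2) (F : Finset ℕ+) :
    ∫⁻ X, ∑ i ∈ F, ENNReal.ofReal (noiseVar p ε i + (X i - θ i) ^ 2) ∂(obsLaw p ε θ) =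
      ENNReal.ofReal (2 * ∑ i ∈ F, noiseVar p ε i) := by
  have hσ := fun i => (noiseVar_pos (p := p) hε i).le
  rw [lintegral_finsetSum' _ fun i _ => ((((measurable_pi_apply i).sub_const _).pow_const 2).const_add
    _).ennreal_ofReal.aemeasurable, Finset.mul_sum,
    ENNReal.ofReal_sum_of_nonneg fun i _ => mul_nonneg zero_le_two (hσ i)]
  refine Finset.sum_congr rfl fun i _ => ?_
  simp_rw [ENNReal.ofReal_add (hσ i) (sq_nonneg _)]
  rw [lintegral_add_left measurable_const, lintegral_const, measure_univ, mul_one, obsLaw,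
    lintegral_eval_infinitePi _ i (f := fun y => ENNReal.ofReal ((y - θ i) ^ 2)) (by fun_prop),
    lintegral_sq_sub_gaussianReal, Real.coe_toNNReal _ (hσ i),
    ← ENNReal.ofReal_add (hσ i) (by simpa using hσ i)]
  congr 1; ring

theorem ScoreDecay.ddm_le_tsum_ite_add {p ε K α : ℝ} {X : ℕ+ → ℝ} (h : ScoreDecay p ε K α X)
    (hε : 0 < ε) (hK : 0 < K + 1) (hα : 0 < α) (s : Set (ℕ+ → ℝ)) (P : ℕ+ → Prop)
    [DecidablePred P] (f : ℕ+ → ℝ≥0∞) (b : ℝ≥0∞)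
    (hf : ∀ I, P I → ENNReal.ofReal (indexProb p ε K α X I) ≤ f I)
    (hb : ∀ I, ¬ P I → componentDDM p ε K X I s ≤ b) :
    ddm p ε K α X s ≤ (∑' I, if P I then f I else 0) + b := by
  have h1 : ∀ I, ENNReal.ofReal (indexProb p ε K α X I) * componentDDM p ε K X I s ≤
      (if P I then f I else 0) + ENNReal.ofReal (indexProb p ε K α X I) * b := by
    intro I
    by_cases hP : P I
    · rw [if_pos hP]
      exact le_add_right ((mul_le_of_le_one_right' prob_le_one).trans (hf I hP))
    · rw [if_neg hP, zero_add]
      gcongr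
      exact hb I hP
  rw [ddm_apply]
  refine (ENNReal.tsum_le_tsum h1).trans ?_
  rw [ENNReal.tsum_add, ENNReal.tsum_mul_right, h.tsum_indexProb hε hK hα, one_mul]

/-- Markov's inequality for a set `S` that need not be measurable, such as an event quantifying over
all centers. -/
theorem measure_bad_le {Ω : Type*} [MeasurableSpace Ω] {μ : Measure Ω} {U : Ω → ℝ≥0∞}
    (hU : Measurable U) {x y : ℝ} (hx : 0 < x) (hy : ∫⁻ ω, U ω ∂μ ≤ ENNReal.ofReal (x * y))
    {G : Ω → Prop} (hG : ∀ᵐ ω ∂μ, G ω) {S : Set Ω}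
    (hS : ∀ ω ∈ S, G ω → ENNReal.ofReal x ≤ U ω) : μ S ≤ ENNReal.ofReal y := by
  have h1 : μ S ≤ μ {ω | ENNReal.ofReal x ≤ U ω} := by
    apply measure_mono_ae
    filter_upwards [hG] with ω hω hωS
    exact hS ω hωS hω
  refine h1.trans ((meas_ge_le_lintegral_div hU.aemeasurable (by simpa using hx)
    ENNReal.ofReal_ne_top).trans ?_)
  rw [ENNReal.div_le_iff (by simpa using hx) ENNReal.ofReal_ne_top, mul_comm,
    ← ENNReal.ofReal_mul hx.le]
  exact hy

/-! ### Concentration around the truth -/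

theorem exists_concentration {p K α : ℝ} (hp : 0 ≤ p) (hK : 1.87 ≤ K) (hα : 0 < α)
    {η : ℝ} (hη : 0 < η) :
    ∃ M : ℝ, 0 < M ∧ ∀ ε : ℝ, 0 < ε → ∀ (θ : Ell2) (J : ℕ+),
      obsLaw p ε θ {X | ENNReal.ofReal η ≤
        ddm p ε K α X (seqBall θ (M * √(localRateSq p ε θ J)))ᶜ} ≤ ENNReal.ofReal η := by
  classical
  have hK1 : 0 < K + 1 := by linarith
  obtain ⟨t, ht0, ht1, hb⟩ := exists_momentRate_pos hK hα
  have hδ : 0 < η * η / 3 := by positivity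
  obtain ⟨N, hN⟩ := exists_tail_sum_le (A := t / (2 * (1 - t))) hb hδ
  have ha0 := coordPenalty_sub_nonneg hK hα
  set a := coordPenalty K α - Real.log 2 / 2 with ha
  set s := 2 * p + 1 with hs
  set G : ℝ := (2 : ℝ) ^ s with hG
  have hG0 : 0 < G := by positivity
  set m := 1 / (η * η / 3) with hm
  have hm0 : 0 < m := by positivity
  -- A bias above `D R` makes the signal-to-noise sum over `(I, J']` at least `4(a + m) J'`, so each
  -- such index has expected weight at most `exp (-m J')`. Fewer than `J'` of them sum to at most
  -- `1/m = η²/3`.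
  set D := 1 + 4 * G * (a + m) with hD
  have hD1 : 1 ≤ D := by
    have : 0 ≤ 4 * G * (a + m) := by positivity
    linarith
  set E := 2 * (((N : ℕ) : ℝ) ^ s * G) + D with hE
  have hE0 : 0 < E := by positivity
  set M := √(E / (η * η / 3)) with hM
  have hM0 : 0 < M := Real.sqrt_pos.2 (by positivity)
  refine ⟨M, hM0, fun ε hε θ J => ?_⟩
  set R := localRateSq p ε θ J with hR
  have hR0 : 0 < R := localRateSq_pos hε θ J
  have hBJ : biasSq θ J ≤ R := by
    rw [hR, localRateSq_eq]; linarith [sum_noiseVar_pos (p := p) hε J]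
  have hVJ : ∑ i ∈ Finset.Icc 1 J, noiseVar p ε i ≤ R := by
    rw [hR, localRateSq_eq]; linarith [biasSq_nonneg θ J]
  -- At `J` the bias may dominate `R`. Moving up to `J'`, where the variance is of order `R`, makes
  -- `R/(ε² J'^{2p})` at most `J'`, as the tail bound requires.
  obtain ⟨J', hJJ', hJ1, hJ2⟩ := exists_index_comparable (y := R / ε ^ 2) hp (J := J) (by
    rw [← mul_div_assoc, le_div_iff₀ (by positivity), mul_comm]
    exact (le_sum_noiseVar hp ε J).trans (by gcongr))
  rw [div_le_iff₀ (by positivity)] at hJ1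
  rw [← mul_div_assoc, le_div_iff₀ (by positivity)] at hJ2
  have hJ'0 : (0 : ℝ) < ((J' : ℕ) : ℝ) := by exact_mod_cast J'.pos
  have hsplit : ((J' : ℕ) : ℝ) ^ s = ((J' : ℕ) : ℝ) ^ (2 * p) * ((J' : ℕ) : ℝ) := by
    rw [hs, Real.rpow_add hJ'0, Real.rpow_one]
  set w := ε ^ 2 * ((J' : ℕ) : ℝ) ^ (2 * p) with hw
  have hw0 : 0 < w := by positivity
  have hJ1' : R ≤ w * ((J' : ℕ) : ℝ) := by
    rw [hsplit] at hJ1; rw [hw]; linarith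
  have hJ2' : w * ((J' : ℕ) : ℝ) ≤ G * R := by
    change _ ^ s * _ ≤ _ at hJ2
    rw [hsplit] at hJ2; rw [hw]; linarith
  have hBJ' : biasSq θ J' ≤ R := (biasSq_anti θ hJJ').trans hBJ
  -- The indices to discard: too large, or too small with excessive bias.
  set P₁ : ℕ+ → Prop := fun I => N * J' < I
  set P₂ : ℕ+ → Prop := fun I => I < J' ∧ D * R < biasSq θ I
  set u : ℝ → ℕ+ → (ℕ+ → ℝ) → ℝ≥0∞ := fun x I X =>
    ENNReal.ofReal (Real.exp (x * (score p ε K α X I - score p ε K α X J'))) with hu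
  have hum : ∀ x I, Measurable (u x I) := fun x I => measurable_exp_mul_score_sub p ε K α x I J'
  set F := Finset.Icc 1 (N * J') with hF
  set W : (ℕ+ → ℝ) → ℝ≥0∞ := fun X =>
    ∑ i ∈ F, ENNReal.ofReal (noiseVar p ε i + (X i - θ i) ^ 2) with hW
  have hWm : Measurable W := Finset.measurable_fun_sum _ fun i _ =>
    ((((measurable_pi_apply i).sub_const _).pow_const 2).const_add _).ennreal_ofReal
  set V : (ℕ+ → ℝ) → ℝ≥0∞ := fun X =>
    (W X + ENNReal.ofReal (D * R)) * (ENNReal.ofReal ((M * √R) ^ 2))⁻¹ with hV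
  have hVm : Measurable V := (hWm.add_const _).mul_const _
  set U₁ : (ℕ+ → ℝ) → ℝ≥0∞ := fun X => ∑' I, if P₁ I then u t I X else 0
  set U₂ : (ℕ+ → ℝ) → ℝ≥0∞ := fun X => ∑' I, if P₂ I then u 1 I X else 0
  have hU₁m : Measurable U₁ := measurable_tsum_ite P₁ (hum t)
  have hU₂m : Measurable U₂ := measurable_tsum_ite P₂ (hum 1)
  have hU₁ : ∫⁻ X, U₁ X ∂(obsLaw p ε θ) ≤ ENNReal.ofReal (η * η / 3) := by
    rw [lintegral_tsum_ite _ P₁ (hum t)]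
    refine le_trans (ENNReal.tsum_le_tsum fun I => ?_) (hN J')
    by_cases h : P₁ I
    · rw [if_pos h, if_pos (show N * J' < I from h)]
      have hle : J' ≤ I := le_trans (by
        have : (J' : ℕ) ≤ (N : ℕ) * (J' : ℕ) := Nat.le_mul_of_pos_left _ N.pos
        exact_mod_cast this) (le_of_lt h)
      refine lintegral_weights_of_gt_le hε ht0.le ht1 θ hle
        ((sum_sq_div_noiseVar_le hp hε θ hle).trans ?_)
      rw [div_le_iff₀ hw0]
      linarith
    · rw [if_neg h]; exact zero_le
  have hU₂ : ∫⁻ X, U₂ X ∂(obsLaw p ε θ) ≤ ENNReal.ofReal (η * η / 3) := by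
    rw [lintegral_tsum_ite _ P₂ (hum 1)]
    have hle : ∀ I, (if P₂ I then ∫⁻ X, u 1 I X ∂(obsLaw p ε θ) else 0) ≤
        if P₂ I then ENNReal.ofReal (Real.exp (-(m * ((J' : ℕ) : ℝ)))) else 0 := by
      intro I
      by_cases h : P₂ I
      · rw [if_pos h, if_pos h]
        refine (lintegral_weights_of_lt_le hε θ h.1.le
          (le_sum_sq_div_noiseVar hp hε θ h.1.le)).trans ?_
        apply ENNReal.ofReal_le_ofReal
        apply Real.exp_le_exp.2
        have h1 : 4 * (a + m) * ((J' : ℕ) : ℝ) ≤ (biasSq θ I - biasSq θ J') / w := by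
          rw [le_div_iff₀ hw0]
          have h2 : 4 * (a + m) * (w * ((J' : ℕ) : ℝ)) ≤ 4 * (a + m) * (G * R) := by gcongr
          have h3 := h.2
          rw [hD] at h3
          nlinarith
        have h4 : (((J' : ℕ) : ℝ) - ((I : ℕ) : ℝ)) * a ≤ ((J' : ℕ) : ℝ) * a := by
          have : (0 : ℝ) ≤ ((I : ℕ) : ℝ) := by positivity
          gcongr; linarith
        rw [← ha, ← hw]
        linarith
      · rw [if_neg h, if_neg h]
    refine (ENNReal.tsum_le_tsum hle).trans
      ((tsum_ite_lt_const_le J' P₂ (fun I h => h.1) _).trans (ENNReal.ofReal_le_ofReal ?_))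
    refine (mul_exp_neg_mul_le hm0).trans (le_of_eq ?_)
    rw [hm, one_div_one_div]
  have hUV : ∫⁻ X, V X ∂(obsLaw p ε θ) ≤ ENNReal.ofReal (η * η / 3) := by
    have hMR : (M * √R) ^ 2 = E / (η * η / 3) * R := by
      rw [mul_pow, Real.sq_sqrt hR0.le, hM, Real.sq_sqrt (by positivity)]
    have hMR0 : 0 < (M * √R) ^ 2 := by rw [hMR]; positivity
    rw [hV, lintegral_mul_const _ (hWm.add_const _), lintegral_add_right _ measurable_const,
      lintegral_const, measure_univ, mul_one, ← div_eq_mul_inv, hW,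
      lintegral_sum_noiseVar_add_sq hε,
      ENNReal.div_le_iff (ENNReal.ofReal_pos.2 hMR0).ne' ENNReal.ofReal_ne_top,
      ← ENNReal.ofReal_add (by
        exact mul_nonneg zero_le_two (Finset.sum_nonneg fun i _ => (noiseVar_pos hε i).le))
        (by positivity), ← ENNReal.ofReal_mul hδ.le, hMR]
    apply ENNReal.ofReal_le_ofReal
    have h1 : ∑ i ∈ F, noiseVar p ε i ≤ ((N : ℕ) : ℝ) ^ s * G * R := by
      refine (sum_noiseVar_le hp ε (N * J')).trans ?_
      rw [PNat.mul_coe, Nat.cast_mul, Real.mul_rpow (by positivity) (by positivity)]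
      calc _ = ((N : ℕ) : ℝ) ^ s * (((J' : ℕ) : ℝ) ^ s * ε ^ 2) := by ring
        _ ≤ ((N : ℕ) : ℝ) ^ s * (G * R) := by gcongr
        _ = _ := by ring
    have h2 : η * η / 3 * (E / (η * η / 3) * R) = E * R := by field_simp
    rw [h2, hE]
    linarith
  have hUm : Measurable fun X => (U₁ X + U₂ X) + V X := (hU₁m.add hU₂m).add hVm
  refine measure_bad_le hUm (y := η) hη ?_ (ae_scoreDecay hp hε hK hα θ) ?_
  · rw [lintegral_add_right _ hVm, lintegral_add_left hU₁m]
    refine (add_le_add (add_le_add hU₁ hU₂) hUV).trans (le_of_eq ?_)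
    rw [← ENNReal.ofReal_add hδ.le hδ.le, ← ENNReal.ofReal_add (by positivity) hδ.le]
    congr 1; ring
  · intro X hX hdec
    refine (le_trans hX (hdec.ddm_le_tsum_ite_add hε hK1 hα _ (fun I => P₁ I ∨ P₂ I)
      (fun I => (if P₁ I then u t I X else 0) + if P₂ I then u 1 I X else 0) (V X)
      ?_ ?_)).trans ?_
    · intro I hI
      by_cases h1 : P₁ I
      · rw [if_pos h1]
        exact le_add_right (ENNReal.ofReal_le_ofReal
          (hdec.indexProb_le hε hK1 hα I J' ht0.le ht1.le))
      · have h2 : P₂ I := hI.resolve_left h1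
        rw [if_pos h2]
        exact le_add_left (ENNReal.ofReal_le_ofReal
          (hdec.indexProb_le hε hK1 hα I J' zero_le_one le_rfl))
    · intro I hI
      push Not at hI
      have h1 : I ≤ N * J' := not_lt.1 hI.1
      have h2 : biasSq θ I ≤ D * R := by
        rcases lt_or_ge I J' with h | h
        · by_contra hcon
          exact hI.2 ⟨h, not_le.1 hcon⟩
        · exact ((biasSq_anti θ h).trans hBJ').trans (le_mul_of_one_le_left hR0.le hD1)
      refine (componentDDM_compl_seqBall_le hε (by linarith)
        (mul_pos hM0 (Real.sqrt_pos.2 hR0)) X θ I).trans ?_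
      refine (ENNReal.div_le_div_right (add_le_add ?_ (ENNReal.ofReal_le_ofReal h2)) _).trans
        (le_of_eq (div_eq_mul_inv _ _))
      exact Finset.sum_le_sum_of_subset (Finset.Icc_subset_Icc le_rfl h1)
    · gcongr
      rw [← ENNReal.tsum_add]
      refine ENNReal.tsum_le_tsum fun I => ?_
      split_ifs <;> simp

/-! ### No small ball carries mass under the excessive bias restriction -/

theorem exists_small_ball {p K α : ℝ} (hp : 0 ≤ p) (hK : 1.87 ≤ K) (hα : 0 < α)
    (hαK : α < 1 / 4 - 1 / 2 * Real.log ((K + 1) / 2)) {η τ : ℝ} (hη : 0 < η) (hτ : 0 < τ) :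
    ∃ δ : ℝ, 0 < δ ∧ ∀ ε : ℝ, 0 < ε → ∀ (θ : Ell2) (J : ℕ+), IsSurrogateOracle p ε θ J →
      biasSq θ J ≤ τ * ∑ i ∈ Finset.Icc 1 J, noiseVar p ε i →
      obsLaw p ε θ {X | ∃ (c : Ell2) (r : ℝ), r ≤ δ * √(localRateSq p ε θ J) ∧
        ENNReal.ofReal η ≤ ddm p ε K α X (seqBall c r)} ≤ ENNReal.ofReal η := by
  classical
  have hK1 : 0 < K + 1 := by linarith
  have hη2 : 0 < η / 2 := half_pos hη
  obtain ⟨δ, hδ, hsmall⟩ := exists_componentDDM_seqBall_le hp (by linarith : 0 < K) (half_pos hη2)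
  have ha := coordPenalty_sub_lt hK hαK
  set a := 1 / 4 - (coordPenalty K α - Real.log 2 / 2) with ha_def
  have ha0 : 0 < a := by linarith
  set x := η / 4 * η with hx
  have hx0 : 0 < x := by positivity
  -- If some index is discarded then `J > N`, and `e^y ≥ y²/2` gives `J exp (-aJ/2) ≤ 8/(a² J) ≤ x`.
  -- The shift to `N = n + 2` ensures `I ≤ J/2` for discarded `I`.
  obtain ⟨n, hn⟩ := exists_nat_ge (8 / (a ^ 2 * x))
  set N : ℕ+ := (n + 1).succPNat with hN
  have hNc : ((N : ℕ) : ℝ) = n + 2 := by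
    rw [hN, Nat.succPNat_coe]; push_cast; ring
  set s := 2 * p + 1 with hs
  set D := (1 + τ) * ((N : ℕ) : ℝ) ^ s with hD
  have hD0 : 0 < D := by positivity
  refine ⟨√(δ / D), Real.sqrt_pos.2 (by positivity), fun ε hε θ J hJ hτJ => ?_⟩
  set R := localRateSq p ε θ J with hR
  have hR0 : 0 < R := localRateSq_pos hε θ J
  set P : ℕ+ → Prop := fun I => N * I < J with hP
  have hPlt : ∀ I, P I → I < J := fun I hI => lt_of_le_of_lt (by
    have : (I : ℕ) ≤ (N : ℕ) * (I : ℕ) := Nat.le_mul_of_pos_left _ N.pos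
    exact_mod_cast this) hI
  set u : ℕ+ → (ℕ+ → ℝ) → ℝ≥0∞ := fun I X =>
    ENNReal.ofReal (Real.exp (1 * (score p ε K α X I - score p ε K α X J))) with hu
  have hum : ∀ I, Measurable (u I) := fun I => measurable_exp_mul_score_sub p ε K α 1 I J
  set U : (ℕ+ → ℝ) → ℝ≥0∞ := fun X => ∑' I, if P I then u I X else 0
  have hUm : Measurable U := measurable_tsum_ite P hum
  have hU : ∫⁻ X, U X ∂(obsLaw p ε θ) ≤ ENNReal.ofReal x := by
    rw [lintegral_tsum_ite _ P hum]
    by_cases hex : ∃ I, P I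
    · obtain ⟨I₀, hI₀⟩ := hex
      have hle : ∀ I, (if P I then ∫⁻ X, u I X ∂(obsLaw p ε θ) else 0) ≤
          if P I then ENNReal.ofReal (Real.exp (-(a / 2 * ((J : ℕ) : ℝ)))) else 0 := by
        intro I
        by_cases h : P I
        · rw [if_pos h, if_pos h]
          refine (lintegral_weights_of_lt_le hε θ (hPlt I h).le
            (le_sum_sq_div_noiseVar_of_surrogate hp hε hJ (hPlt I h).le)).trans ?_
          apply ENNReal.ofReal_le_ofReal
          apply Real.exp_le_exp.2
          have h1 : ((N : ℕ) : ℝ) * ((I : ℕ) : ℝ) ≤ ((J : ℕ) : ℝ) := by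
            have : (N : ℕ) * (I : ℕ) < (J : ℕ) := by exact_mod_cast h
            exact_mod_cast this.le
          have h2 : 2 * ((I : ℕ) : ℝ) ≤ ((J : ℕ) : ℝ) := by
            refine le_trans ?_ h1
            gcongr
            rw [hNc]; linarith [(Nat.cast_nonneg n : (0 : ℝ) ≤ n)]
          have h3 : coordPenalty K α - Real.log 2 / 2 = 1 / 4 - a := by rw [ha_def]; ring
          rw [h3]
          nlinarith
        · rw [if_neg h, if_neg h]
      refine (ENNReal.tsum_le_tsum hle).trans
        ((tsum_ite_lt_const_le J P hPlt _).trans (ENNReal.ofReal_le_ofReal ?_))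
      have hNJ : (n : ℝ) ≤ ((J : ℕ) : ℝ) := by
        have h1 : (N : ℕ) * (I₀ : ℕ) < (J : ℕ) := by exact_mod_cast hI₀
        have h2 : (N : ℕ) ≤ (N : ℕ) * (I₀ : ℕ) := Nat.le_mul_of_pos_right _ I₀.pos
        have h3 : ((N : ℕ) : ℝ) ≤ ((J : ℕ) : ℝ) := by exact_mod_cast h2.trans h1.le
        linarith
      have hJ0 : (0 : ℝ) < ((J : ℕ) : ℝ) := by exact_mod_cast J.pos
      rw [div_le_iff₀ (by positivity)] at hn
      have h4 : 8 ≤ ((J : ℕ) : ℝ) * (a ^ 2 * x) := hn.trans (by gcongr)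
      have h5 : (a / 2 * ((J : ℕ) : ℝ)) ^ 2 / 2 ≤ Real.exp (a / 2 * ((J : ℕ) : ℝ)) := by
        have := Real.quadratic_le_exp_of_nonneg (by positivity : 0 ≤ a / 2 * ((J : ℕ) : ℝ))
        have : 0 ≤ a / 2 * ((J : ℕ) : ℝ) := by positivity
        linarith
      rw [Real.exp_neg, ← div_eq_mul_inv, div_le_iff₀ (Real.exp_pos _)]
      calc ((J : ℕ) : ℝ) ≤ x * ((a / 2 * ((J : ℕ) : ℝ)) ^ 2 / 2) := by nlinarith
        _ ≤ _ := by gcongr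
    · push Not at hex
      simp [hex]
  refine measure_bad_le hUm (x := η / 4) (y := η) (by positivity) hU
    (ae_scoreDecay hp hε hK hα θ) ?_
  rintro X ⟨c, r, hr, hmass⟩ hdec
  have hle : ddm p ε K α X (seqBall c r) ≤ U X + ENNReal.ofReal (η / 2 / 2) := by
    rcases lt_or_ge r 0 with hr0 | hr0
    · rw [seqBall_eq_empty hr0, measure_empty]; exact zero_le
    · refine hdec.ddm_le_tsum_ite_add hε hK1 hα _ P (fun I => u I X) _ ?_ ?_
      · intro I _
        exact ENNReal.ofReal_le_ofReal (hdec.indexProb_le hε hK1 hα I J zero_le_one le_rfl)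
      · intro I hI
        refine hsmall ε hε X c I r hr0 ?_
        have h1 : ((J : ℕ) : ℝ) ≤ ((N : ℕ) : ℝ) * ((I : ℕ) : ℝ) := by
          have : (J : ℕ) ≤ (N : ℕ) * (I : ℕ) := by exact_mod_cast not_lt.1 hI
          exact_mod_cast this
        -- The bias restriction bounds `R` by the variance at `J`, and `J ≤ N I` passes this on to
        -- every retained `I`.
        have h2 : R ≤ D * (ε ^ 2 * ((I : ℕ) : ℝ) ^ s) := by
          calc R ≤ (1 + τ) * ∑ i ∈ Finset.Icc 1 J, noiseVar p ε i := by
                rw [hR, localRateSq_eq]; linarith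
            _ ≤ (1 + τ) * (ε ^ 2 * ((J : ℕ) : ℝ) ^ s) := by
                gcongr; exact sum_noiseVar_le hp ε J
            _ ≤ (1 + τ) * (ε ^ 2 * (((N : ℕ) : ℝ) * ((I : ℕ) : ℝ)) ^ s) := by
                gcongr
            _ = _ := by
                rw [Real.mul_rpow (by positivity) (by positivity), hD]; ring
        calc r ^ 2 ≤ (√(δ / D) * √R) ^ 2 := by gcongr
          _ = δ / D * R := by
              rw [mul_pow, Real.sq_sqrt (by positivity), Real.sq_sqrt hR0.le]
          _ ≤ δ / D * (D * (ε ^ 2 * ((I : ℕ) : ℝ) ^ s)) := by gcongr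
          _ = _ := by field_simp
  have h1 : ENNReal.ofReal η ≤ U X + ENNReal.ofReal (η / 2 / 2) := hmass.trans hle
  have h2 : ENNReal.ofReal (η / 4) + ENNReal.ofReal (η / 2 / 2) ≤
      U X + ENNReal.ofReal (η / 2 / 2) := by
    refine le_trans ?_ h1
    rw [← ENNReal.ofReal_add (by positivity) (by positivity)]
    exact ENNReal.ofReal_le_ofReal (by linarith)
  exact (ENNReal.add_le_add_iff_right ENNReal.ofReal_ne_top).1 h2

/-! ### Credible balls around the default center -/

theorem seqBall_subset_seqBall {c c' : Ell2} {r r' : ℝ} (h : r + dist c c' ≤ r') :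
    seqBall c r ⊆ seqBall c' r' :=
  Set.image_mono (Metric.closedBall_subset_closedBall' h)

theorem dist_le_of_seqBall_inter_nonempty {c c' : Ell2} {r r' : ℝ}
    (h : (seqBall c r ∩ seqBall c' r').Nonempty) : dist c c' ≤ r + r' := by
  obtain ⟨x, ⟨θ, hθ, rfl⟩, ⟨θ', hθ', h⟩⟩ := h
  have : θ' = θ := lp.ext h
  subst this
  exact (dist_triangle_left c c' θ').trans (add_le_add hθ hθ')

theorem nonneg_of_ofReal_le_ballMass {p ε K α x r : ℝ} {X : ℕ+ → ℝ} {c : Ell2} (hx : 0 < x)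
    (h : ENNReal.ofReal x ≤ ballMass p ε K α X c r) : 0 ≤ r := by
  by_contra hr
  rw [ballMass_eq, seqBall_eq_empty (not_le.1 hr), measure_empty, nonpos_iff_eq_zero,
    ENNReal.ofReal_eq_zero] at h
  linarith

theorem ofReal_le_measure_of_compl_lt {Ω : Type*} [MeasurableSpace Ω] {μ : Measure Ω}
    [IsProbabilityMeasure μ] {s : Set Ω} (hs : MeasurableSet s) {η : ℝ} (hη : 0 ≤ η)
    (h : μ sᶜ < ENNReal.ofReal η) : ENNReal.ofReal (1 - η) ≤ μ s := by
  rw [ENNReal.ofReal_sub _ hη, ENNReal.ofReal_one, tsub_le_iff_right,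
    ← prob_add_prob_compl (μ := μ) hs]
  gcongr

theorem credRadius_le {p ε K α κ r : ℝ} {X : ℕ+ → ℝ} {c : Ell2} (hκ : κ < 1)
    (h : ENNReal.ofReal (1 - κ) ≤ ballMass p ε K α X c r) : credRadius p ε K α κ X c ≤ r :=
  csInf_le ⟨0, fun _ hr => nonneg_of_ofReal_le_ballMass (sub_pos.2 hκ) hr⟩ h

theorem minRadius_le {p ε K α q r : ℝ} {X : ℕ+ → ℝ} {c : Ell2} (hq : 0 < q)
    (h : ENNReal.ofReal q ≤ ballMass p ε K α X c r) : minRadius p ε K α q X ≤ r :=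
  csInf_le ⟨0, fun _ ⟨_, hr⟩ => nonneg_of_ofReal_le_ballMass hq hr⟩ ⟨c, h⟩

/-- The two balls have masses at least `1 - η ≥ q` and `q`, with `2q > 1`, so they intersect; `r̂* ≤
r` because the ball around `θ` competes in its definition. The triangle inequality does the rest. -/
theorem dist_center_le_and_mass_ge {p ε K α κ q ς η r : ℝ} {X : ℕ+ → ℝ} {θ c : Ell2}
    (hq : 1 / 2 < q) (hς : 0 < ς) (hη : 0 < η) (hηq : η ≤ 1 - q) (hηκ : η ≤ κ)
    [IsProbabilityMeasure (ddm p ε K α X)]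
    (hθ : ddm p ε K α X (seqBall θ r)ᶜ < ENNReal.ofReal η)
    (hc : ENNReal.ofReal q ≤ ballMass p ε K α X c ((1 + ς) * minRadius p ε K α q X)) :
    dist θ c ≤ (2 + ς) * r ∧
      ENNReal.ofReal (1 - κ) ≤ ballMass p ε K α X c ((3 + ς) * r) := by
  have hmass := ofReal_le_measure_of_compl_lt (measurableSet_seqBall θ r) hη.le hθ
  have hmin : minRadius p ε K α q X ≤ r :=
    minRadius_le (c := θ) (by linarith)
      (le_trans (ENNReal.ofReal_le_ofReal (by linarith)) hmass)
  have hinter : (seqBall θ r ∩ seqBall c ((1 + ς) * minRadius p ε K α q X)).Nonempty := by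
    by_contra hne
    rw [Set.not_nonempty_iff_eq_empty, ← Set.disjoint_iff_inter_eq_empty] at hne
    have h1 := measure_union (μ := ddm p ε K α X) hne (measurableSet_seqBall c _)
    have h2 : ENNReal.ofReal (1 - η) + ENNReal.ofReal q ≤ 1 :=
      (add_le_add hmass hc).trans (h1 ▸ prob_le_one)
    rw [← ENNReal.ofReal_add (by linarith) (by linarith), ENNReal.ofReal_le_one] at h2
    linarith
  have hdist := dist_le_of_seqBall_inter_nonempty hinter
  have h3 : (1 + ς) * minRadius p ε K α q X ≤ (1 + ς) * r := by gcongr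
  have h4 : dist θ c ≤ (2 + ς) * r := by linarith
  refine ⟨h4, (ENNReal.ofReal_le_ofReal (by linarith)).trans (hmass.trans ?_)⟩
  exact measure_mono (seqBall_subset_seqBall (by linarith))

theorem iInf_localRateSq_pos {p ε : ℝ} (hp : 0 ≤ p) (hε : 0 < ε) (θ : Ell2) :
    0 < ⨅ I : ℕ+, localRateSq p ε θ I := by
  refine lt_of_lt_of_le (by positivity : 0 < ε ^ 2) (le_ciInf fun I => ?_)
  rw [localRateSq_eq]
  have h1 : noiseVar p ε 1 ≤ ∑ i ∈ Finset.Icc 1 I, noiseVar p ε i :=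
    Finset.single_le_sum (fun i _ => (noiseVar_pos hε i).le) (by simp)
  linarith [sq_le_noiseVar (ε := ε) hp 1, biasSq_nonneg θ I]

/-- Concentration holds at every `J`, so a near-minimizer suffices and attainment of the infimum is
not needed. -/
theorem exists_sqrt_localRateSq_le {p ε : ℝ} (hp : 0 ≤ p) (hε : 0 < ε) (θ : Ell2) :
    ∃ J : ℕ+, √(localRateSq p ε θ J) ≤ 2 * oracleRate p ε θ := by
  have h0 := iInf_localRateSq_pos hp hε θ
  obtain ⟨J, hJ⟩ := exists_lt_of_ciInf_lt
    (show ⨅ I : ℕ+, localRateSq p ε θ I < 2 ^ 2 * ⨅ I : ℕ+, localRateSq p ε θ I by linarith)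
  refine ⟨J, (Real.sqrt_le_sqrt hJ.le).trans (le_of_eq ?_)⟩
  rw [Real.sqrt_mul (by norm_num), Real.sqrt_sq (by norm_num), oracleRate]

theorem theorem3p4 (p K α κ q ς : ℝ) (hp : 0 ≤ p) (hK : 1.87 ≤ K) (hα : 0 < α)
    (hαK : α < 1 / 4 - 1 / 2 * Real.log ((K + 1) / 2))
    (hκ : κ ∈ Set.Ioo (0 : ℝ) 1) (hq : q ∈ Set.Ioo (1 / 2 : ℝ) 1) (hς : 0 < ς) :
    (∀ τ : ℝ, 0 < τ → ∀ α₁ ∈ Set.Ioo (0 : ℝ) 1, ∃ C₀ : ℝ, 0 < C₀ ∧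
      ∀ ε : ℝ, 0 < ε → ∀ c : (ℕ+ → ℝ) → Ell2, IsDefaultCenter p ε K α q ς c →
        ∀ C : ℝ, C₀ ≤ C → ∀ θ₀ ∈ excessiveBiasClass p ε τ,
          obsLaw p ε θ₀ {X | θ₀ ∉ Metric.closedBall (c X) (C * credRadius p ε K α κ X (c X))}
            ≤ ENNReal.ofReal α₁) ∧
    (∀ α₂ ∈ Set.Ioo (0 : ℝ) 1, ∃ c₀ : ℝ, 0 < c₀ ∧
      ∀ ε : ℝ, 0 < ε → ∀ c : (ℕ+ → ℝ) → Ell2, IsDefaultCenter p ε K α q ς c →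
        ∀ b : ℝ, c₀ ≤ b → ∀ θ₀ : Ell2,
          obsLaw p ε θ₀ {X | b * oracleRate p ε θ₀ ≤ credRadius p ε K α κ X (c X)}
            ≤ ENNReal.ofReal α₂) := by
  obtain ⟨hκ0, hκ1⟩ := hκ
  obtain ⟨hq0, hq1⟩ := hq
  have hK1 : 0 < K + 1 := by linarith
  constructor
  · rintro τ hτ α₁ ⟨hα₁, -⟩
    set η := min (min (1 - q) κ) (min (1 - κ) (α₁ / 2))
    have hη : 0 < η := lt_min (lt_min (by linarith) hκ0) (lt_min (by linarith) (by linarith))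
    have hηq : η ≤ 1 - q := (min_le_left _ _).trans (min_le_left _ _)
    have hηκ : η ≤ κ := (min_le_left _ _).trans (min_le_right _ _)
    have hηκ' : η ≤ 1 - κ := (min_le_right _ _).trans (min_le_left _ _)
    have hηα : η ≤ α₁ / 2 := (min_le_right _ _).trans (min_le_right _ _)
    obtain ⟨M, hM, hconc⟩ := exists_concentration hp hK hα hη
    obtain ⟨δ, hδ, hsmall⟩ := exists_small_ball hp hK hα hαK hη hτ
    refine ⟨(2 + ς) * M / δ, by positivity, fun ε hε c hc C hC θ hθ => ?_⟩
    obtain ⟨J, hJ, hτJ⟩ := hθ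
    set R := √(localRateSq p ε θ J)
    have hR : 0 < R := Real.sqrt_pos.2 (localRateSq_pos hε θ J)
    set S₁ := {X | ENNReal.ofReal η ≤ ddm p ε K α X (seqBall θ (M * R))ᶜ}
    set S₂ := {X | ∃ (c : Ell2) (r : ℝ), r ≤ δ * R ∧
        ENNReal.ofReal η ≤ ddm p ε K α X (seqBall c r)}
    have hsub : obsLaw p ε θ
        {X | θ ∉ Metric.closedBall (c X) (C * credRadius p ε K α κ X (c X))} ≤
        obsLaw p ε θ (S₁ ∪ S₂) := by
      apply measure_mono_ae
      filter_upwards [ae_scoreDecay hp hε hK hα θ, hc.mass_ge θ] with X hdec hcX hX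
      by_contra hS
      obtain ⟨hS₁, hS₂⟩ := not_or.1 hS
      have := hdec.isProbabilityMeasure hε hK1 hα
      obtain ⟨h1, h2⟩ := dist_center_le_and_mass_ge hq0 hς hη hηq hηκ (not_le.1 hS₁) hcX
      -- A smaller radius would give a ball of mass at least `1 - κ ≥ η` and radius at most `δR`,
      -- which is excluded off `S₂`.
      have h3 : δ * R ≤ credRadius p ε K α κ X (c X) := by
        refine le_csInf ⟨_, h2⟩ fun r hr => ?_
        by_contra hlt
        exact hS₂ ⟨c X, r, (not_le.1 hlt).le,
          (ENNReal.ofReal_le_ofReal hηκ').trans hr⟩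
      have hC0 : 0 ≤ C := le_trans (by positivity) hC
      apply hX
      rw [Metric.mem_closedBall]
      calc dist θ (c X) ≤ (2 + ς) * (M * R) := h1
        _ = (2 + ς) * M / δ * (δ * R) := by field_simp
        _ ≤ C * credRadius p ε K α κ X (c X) := by gcongr
    refine hsub.trans ((measure_union_le _ _).trans
      ((add_le_add (hconc ε hε θ J) (hsmall ε hε θ J hJ hτJ)).trans ?_))
    rw [← ENNReal.ofReal_add hη.le hη.le]
    exact ENNReal.ofReal_le_ofReal (by linarith)
  · rintro α₂ ⟨hα₂, -⟩
    set η := min (min (1 - q) κ) α₂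
    have hη : 0 < η := lt_min (lt_min (by linarith) hκ0) hα₂
    have hηq : η ≤ 1 - q := (min_le_left _ _).trans (min_le_left _ _)
    have hηκ : η ≤ κ := (min_le_left _ _).trans (min_le_right _ _)
    have hηα : η ≤ α₂ := min_le_right _ _
    obtain ⟨M, hM, hconc⟩ := exists_concentration hp hK hα hη
    -- The extra `1` makes the comparison strict, since the event includes equality.
    refine ⟨2 * (3 + ς) * M + 1, by positivity, fun ε hε c hc b hb θ => ?_⟩
    obtain ⟨J, hJ⟩ := exists_sqrt_localRateSq_le hp hε θ
    refine le_trans ?_ ((hconc ε hε θ J).trans (ENNReal.ofReal_le_ofReal hηα))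
    apply measure_mono_ae
    filter_upwards [ae_scoreDecay hp hε hK hα θ, hc.mass_ge θ] with X hdec hcX hX
    by_contra hS
    have := hdec.isProbabilityMeasure hε hK1 hα
    obtain ⟨-, h2⟩ := dist_center_le_and_mass_ge hq0 hς hη hηq hηκ (not_le.1 hS) hcX
    have h3 := (show b * oracleRate p ε θ ≤ _ from hX).trans (credRadius_le hκ1 h2)
    have h4 : 0 < oracleRate p ε θ := Real.sqrt_pos.2 (iInf_localRateSq_pos hp hε θ)
    have h5 : (3 + ς) * (M * √(localRateSq p ε θ J)) ≤ (3 + ς) * (M * (2 * oracleRate p ε θ)) := by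
      gcongr
    have h6 : (2 * (3 + ς) * M + 1) * oracleRate p ε θ ≤ b * oracleRate p ε θ := by gcongr
    linarith
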